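/- Let $\Bbbk$ be an algebraically closed field, let $n$ be a natural number, and let $\operatorname{rep}_\Bbbk A_n$ be the category of finite-dimensional representations (persistence modules) $M_1\to M_2\to\cdots\to M_n$ of the equioriented quiver $A_n\colon 1\to 2\to\cdots\to n$. For $s\le t$ let $\phi_M(s,t)\colon M_s\to M_t$ be the composite of the structure maps. For an integer $\delta\ge 0$, the $\delta$-shift $M(\delta)$ is given by $M(\delta)_x=M_{x+\delta}$ if $x+\delta\le n$ and $M(\delta)_x=0$ otherwise, with the structure maps of $M$ where both ends are vertices and $0$ otherwise. This is an exact functor, so it induces a functor $(\delta)$ on the bounded derived category $\mathsf D^{\mathrm b}(\operatorname{rep}_\Bbbk A_n)$ by applying it to the terms and differentials of complexes, and $H^i(X(\delta))$ is identified with $H^i(X)(\delta)$. The transition morphism $\phi^\delta_M\colon M\to M(\delta)$ is $\phi_M(x,x+\delta)$ at each vertex $x$ with $x+\delta\le n$, and $0$ at the other vertices. Morphisms $f\colon M\to N(\delta)$ and $g\colon N\to M(\delta)$ form a $\delta$-interleaving pair if $g(\delta)\circ f=\phi_M^{2\delta}$ and $f(\delta)\circ g=\phi_N^{2\delta}$.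 Objects $X,Y$ of $\mathsf D^{\mathrm b}(\operatorname{rep}_\Bbbk A_n)$ are derived $\delta$-interleaved if there are morphisms $f\colon X\to Y(\delta)$ and $g\colon Y\to X(\delta)$ in $\mathsf D^{\mathrm b}(\operatorname{rep}_\Bbbk A_n)$ such that for every $i\in\mathbb Z$ the pair $(H^i(f),H^i(g))$ is a $\delta$-interleaving pair between $H^i(X)$ and $H^i(Y)$. The derived interleaving distance is $$d_I^D(X,Y)=\inf\{\delta\in\mathbb Z_{\ge 0}\mid X\text{ and }Y\text{ are derived }\delta\text{-interleaved}\}.$$ For $1\le b\le d\le n$ let $\mathbb I[b,d]$ be the interval representation, which is $\Bbbk$ at the vertices $b\le x\le d$ and $0$ elsewhere, with identity maps between vertices in $[b,d]$. Every $M$ has a unique decomposition $M\cong\bigoplus_{b\le d}\mathbb I[b,d]^{m(b,d)}$, and its barcode $\mathcal B(M)$ is the multiset of intervals $\langle b,d\rangle$ with multiplicities $m(b,d)$. Two barcodes $\mathcal B,\mathcal B'$ are $\delta$-matched if there is a bijection $\sigma$ from a subset of $\mathcal B$ onto a subset of $\mathcal B'$ such that every $\langle b,d\rangle$ in $\mathcal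 B$ or in $\mathcal B'$ with $d-b\ge 2\delta$ lies in the domain, respectively in the image, of $\sigma$, and such that $\sigma\langle b,d\rangle=\langle b',d'\rangle$ implies $b'-\delta\le b\le d\le d'+\delta$ and $b-\delta\le b'\le d'\le d+\delta$. The derived barcode $\mathcal B^D(X)$ is the disjoint union over $i\in\mathbb Z$ of the barcodes $\mathcal B(H^i(X))$; two derived barcodes $\mathcal B^D(X)$ and $\mathcal B^D(Y)$ are $\delta$-matched if $\mathcal B(H^i(X))$ and $\mathcal B(H^i(Y))$ are $\delta$-matched for every $i\in\mathbb Z$, and the derived bottleneck distance $d_B^D(\mathcal B^D(X),\mathcal B^D(Y))$ is the infimum of the integers $\delta\ge 0$ for which they are $\delta$-matched. **Theorem (Isometry theorem for derived categories).** For all $X,Y$ in $\mathsf D^{\mathrm b}(\operatorname{rep}_\Bbbk A_n)$, $$d_B^D\bigl(\mathcal B^D(X),\mathcal B^D(Y)\bigr)=d_I^D(X,Y).$$ -/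

import Mathlib

open CategoryTheory CategoryTheory.Limits
open scoped ENNReal

universe w u

namespace DerivedPersistence

noncomputable section

/-! ### Persistence modules, i.e. representations of the equioriented quiver `1 → 2 → ⋯ → n` -/

/-- The category `rep_k A_n` of finite dimensional representations `M₁ → M₂ → ⋯ → Mₙ` of the
equioriented quiver `A_n`.  The free category on `A_n` is the linearly ordered set `Fin n`
(vertex `x + 1` of the quiver is the element `x` of `Fin n`), so a representation is a functor from
`Fin n` to finite dimensional vector spaces, and `M.map (s ≤ t)` is the composite
`φ_M(s, t) : M_s → M_t` of the structure maps along the path from `s` to `t`. -/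
abbrev Rep (k : Type u) [Field k] (n : ℕ) := Fin n ⥤ FGModuleCat.{u} k

variable {k : Type u} [Field k] {n : ℕ}

/-- The linear map `φ_M(s, t) : M_s → M_t` for vertices `s ≤ t`. -/
abbrev structMap (M : Rep k n) {s t : Fin n} (h : s ≤ t) : M.obj s →ₗ[k] M.obj t :=
  (M.map (homOfLE h)).hom.hom

lemma structMap_refl (M : Rep k n) {s : Fin n} (h : s ≤ s) (v : M.obj s) :
    structMap M h v = v :=
  congr($(M.map_id s) v)

lemma structMap_structMap (M : Rep k n) {r s t : Fin n} (h : r ≤ s) (h' : s ≤ t) (v : M.obj r) :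
    structMap M h' (structMap M h v) = structMap M (h.trans h') v :=
  congr($(M.map_comp (homOfLE h) (homOfLE h')) v).symm

lemma app_structMap {M N : Rep k n} (f : M ⟶ N) {s t : Fin n} (h : s ≤ t) (v : M.obj s) :
    (f.app t).hom.hom (structMap M h v) = structMap N h ((f.app s).hom.hom v) :=
  congr($(f.naturality (homOfLE h)) v)

/-- The space `M_{x + δ}` if `x + δ` is a vertex of the quiver, and `0` otherwise: it is written as
the product of the spaces `M_{x + δ}` over the (at most one) proofs that `x + δ` is a vertex. -/
abbrev ShiftSpace (δ : ℕ) (M : Rep k n) (x : Fin n) : Type u :=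
  (h : PLift (x.val + δ < n)) → M.obj ⟨x.val + δ, h.down⟩

/-- The projection of `M(δ)_x` onto `M_{x + δ}`, if `x + δ` is a vertex. -/
abbrev shiftProj (δ : ℕ) (M : Rep k n) (x : Fin n) (h : x.val + δ < n) :
    ShiftSpace δ M x →ₗ[k] M.obj ⟨x.val + δ, h⟩ :=
  LinearMap.proj (φ := fun h : PLift (x.val + δ < n) => M.obj ⟨x.val + δ, h.down⟩) ⟨h⟩

/-- The `δ`-shift `M(δ)` of a persistence module, with `M(δ)_x = M_{x + δ}` if `x + δ` is a vertex
of the quiver and `M(δ)_x = 0` otherwise, and with the structure maps of `M`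
(or zero, when the target is zero). -/
def shiftObj (δ : ℕ) (M : Rep k n) : Rep k n where
  obj x := FGModuleCat.of k (ShiftSpace δ M x)
  map {x y} f := FGModuleCat.ofHom <| LinearMap.pi fun h : PLift (y.val + δ < n) =>
    have hxy : x.val + δ ≤ y.val + δ := Nat.add_le_add_right (leOfHom f) δ
    structMap M (s := ⟨x.val + δ, hxy.trans_lt h.down⟩) (t := ⟨y.val + δ, h.down⟩) hxy ∘ₗ
      shiftProj δ M x (hxy.trans_lt h.down)
  map_id _ := FGModuleCat.hom_ext <| LinearMap.ext fun _ => funext fun _ => structMap_refl M _ _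
  map_comp _ _ := FGModuleCat.hom_ext <| LinearMap.ext fun _ => funext fun _ =>
    (structMap_structMap M _ _ _).symm

/-- The `δ`-shift `f(δ)` of a morphism: `f(δ)_x = f_{x + δ}` if `x + δ` is a vertex of the quiver,
and `0` otherwise. -/
def shiftMap (δ : ℕ) {M N : Rep k n} (f : M ⟶ N) : shiftObj δ M ⟶ shiftObj δ N where
  app x := FGModuleCat.ofHom <| LinearMap.pi fun h : PLift (x.val + δ < n) =>
    (f.app ⟨x.val + δ, h.down⟩).hom.hom ∘ₗ shiftProj δ M x h.down
  naturality _ _ _ := FGModuleCat.hom_ext <| LinearMap.ext fun _ => funext fun _ =>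
    app_structMap f _ _

variable (k n) in
/-- The `δ`-shift functor `(δ) : rep_k A_n ⥤ rep_k A_n`. -/
def shift (δ : ℕ) : Rep k n ⥤ Rep k n where
  obj := shiftObj δ
  map := shiftMap δ
  map_id _ := rfl
  map_comp _ _ := rfl

/-- The transition morphism `φ_M^δ : M ⟶ M(δ)`, equal to `φ_M(x, x + δ)` at the vertex `x`
(and to `0` if `x + δ` is not a vertex). -/
def transition (δ : ℕ) (M : Rep k n) : M ⟶ (shift k n δ).obj M where
  app x := FGModuleCat.ofHom <| LinearMap.pi fun h : PLift (x.val + δ < n) =>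
    structMap M (s := x) (t := ⟨x.val + δ, h.down⟩) (Nat.le_add_right x.val δ)
  naturality _ y f := FGModuleCat.hom_ext <| LinearMap.ext fun v => funext fun h =>
    (structMap_structMap M (leOfHom f) (t := ⟨y.val + δ, h.down⟩) (Nat.le_add_right y.val δ)
      v).trans (structMap_structMap M _ _ v).symm

/-- The canonical map `M(δ)(δ) → M(2δ)` at the vertex `x`: the identity of `M_{x + 2δ}`, if
`x + 2δ` is a vertex. -/
def shiftShiftHom (δ : ℕ) (M : Rep k n) (x : Fin n) :
    ShiftSpace δ (shiftObj δ M) x →ₗ[k] ShiftSpace (2 * δ) M x :=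
  LinearMap.pi fun h : PLift (x.val + 2 * δ < n) =>
    have e : x.val + δ + δ = x.val + 2 * δ := by omega
    have h' : x.val + δ + δ < n := e.trans_lt h.down
    structMap M (s := ⟨x.val + δ + δ, h'⟩) (t := ⟨x.val + 2 * δ, h.down⟩) e.le ∘ₗ
      shiftProj δ M ⟨x.val + δ, (Nat.le_add_right _ δ).trans_lt h'⟩ h' ∘ₗ
      shiftProj δ (shiftObj δ M) x ((Nat.le_add_right _ δ).trans_lt h')

/-- The canonical map `M(2δ) → M(δ)(δ)` at the vertex `x`: the identity of `M_{x + 2δ}`, if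
`x + 2δ` is a vertex. -/
def shiftShiftInv (δ : ℕ) (M : Rep k n) (x : Fin n) :
    ShiftSpace (2 * δ) M x →ₗ[k] ShiftSpace δ (shiftObj δ M) x :=
  LinearMap.pi fun h : PLift (x.val + δ < n) =>
    (LinearMap.pi fun h' : PLift (x.val + δ + δ < n) =>
      have e : x.val + 2 * δ = x.val + δ + δ := by omega
      structMap M (s := ⟨x.val + 2 * δ, e.trans_lt h'.down⟩) (t := ⟨x.val + δ + δ, h'.down⟩) e.le ∘ₗ
        shiftProj (2 * δ) M x (e.trans_lt h'.down) :
      ShiftSpace (2 * δ) M x →ₗ[k] ShiftSpace δ M ⟨x.val + δ, h.down⟩)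

/-- The canonical identification `M(δ)(δ) ≅ M(2δ)`. -/
def shiftShiftIso (δ : ℕ) (M : Rep k n) :
    (shift k n δ).obj ((shift k n δ).obj M) ≅ (shift k n (2 * δ)).obj M :=
  NatIso.ofComponents
    (fun x =>
      { hom := ⟨ModuleCat.ofHom (shiftShiftHom δ M x)⟩
        inv := ⟨ModuleCat.ofHom (shiftShiftInv δ M x)⟩
        hom_inv_id := FGModuleCat.hom_ext <| LinearMap.ext fun v => funext fun h => funext fun h' =>
          (structMap_structMap M _ _ (v h h')).trans (structMap_refl M _ _)
        inv_hom_id := FGModuleCat.hom_ext <| LinearMap.ext fun v => funext fun h =>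
          (structMap_structMap M _ _ (v h)).trans (structMap_refl M _ _) })
    (fun _ => FGModuleCat.hom_ext <| LinearMap.ext fun _ => funext fun _ =>
      (structMap_structMap M _ _ _).trans (structMap_structMap M _ _ _).symm)

/-! ### Exactness of the shift functor -/

/-- At a vertex `x` such that `x + δ` is a vertex, `M(δ)_x` is `M_{x + δ}`. -/
def shiftEvalIso (δ : ℕ) (x : Fin n) (h : x.val + δ < n) :
    shift k n δ ⋙ (evaluation (Fin n) (FGModuleCat.{u} k)).obj x ≅
      (evaluation (Fin n) (FGModuleCat.{u} k)).obj ⟨x.val + δ, h⟩ :=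
  NatIso.ofComponents
    (fun M =>
      { hom := FGModuleCat.ofHom (V := ShiftSpace δ M x) (W := M.obj ⟨x.val + δ, h⟩)
          (LinearMap.proj ⟨h⟩)
        inv := FGModuleCat.ofHom (V := M.obj ⟨x.val + δ, h⟩) (W := ShiftSpace δ M x)
          (LinearMap.pi fun _ => LinearMap.id)
        hom_inv_id := rfl
        inv_hom_id := rfl })
    (fun _ => rfl)

/-- At a vertex `x` such that `x + δ` is not a vertex, `M(δ)_x` is `0`. -/
lemma isZero_shift_eval (δ : ℕ) (x : Fin n) (h : ¬ x.val + δ < n) :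
    IsZero (shift k n δ ⋙ (evaluation (Fin n) (FGModuleCat.{u} k)).obj x) := by
  refine (Functor.isZero_iff _).2 fun M => (IsZero.iff_id_eq_zero _).2 ?_
  exact FGModuleCat.hom_ext (LinearMap.ext fun v => funext fun h' => absurd h'.down h)

instance (δ : ℕ) : (shift k n δ).Additive where
  map_add := rfl

instance (δ : ℕ) : PreservesFiniteLimits (shift k n δ) :=
  preservesFiniteLimits_of_evaluation _ fun x => by
    by_cases h : x.val + δ < n
    · exact preservesFiniteLimits_of_natIso (shiftEvalIso δ x h).symm
    · exact ⟨fun J _ _ => Functor.preservesLimitsOfShape_of_isZero _ (isZero_shift_eval δ x h) J⟩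

instance (δ : ℕ) : PreservesFiniteColimits (shift k n δ) :=
  preservesFiniteColimits_of_evaluation _ fun x => by
    by_cases h : x.val + δ < n
    · exact preservesFiniteColimits_of_natIso (shiftEvalIso δ x h).symm
    · exact ⟨fun J _ _ => Functor.preservesColimitsOfShape_of_isZero _ (isZero_shift_eval δ x h) J⟩

/-! ### Interleavings of persistence modules -/

/-- `f : M ⟶ N(δ)` and `g : N ⟶ M(δ)` form a `δ`-interleaving pair: `g(δ) ∘ f = φ_M^{2δ}` and
`f(δ) ∘ g = φ_N^{2δ}`. -/
def IsInterleavingPair (δ : ℕ) {M N : Rep k n}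
    (f : M ⟶ (shift k n δ).obj N) (g : N ⟶ (shift k n δ).obj M) : Prop :=
  f ≫ (shift k n δ).map g ≫ (shiftShiftIso δ M).hom = transition (2 * δ) M ∧
    g ≫ (shift k n δ).map f ≫ (shiftShiftIso δ N).hom = transition (2 * δ) N

/-! ### Interval representations and barcodes -/

/-- The space of the interval representation `𝕀[b, d]` at the vertex `x`: it is `k` if `b ≤ x ≤ d`
and `0` otherwise, written as the product of copies of `k` over the (at most one) proofs of
`b ≤ x ≤ d`. -/
abbrev IntervalSpace (k : Type u) (I : NonemptyInterval (Fin n)) (x : Fin n) : Type u :=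
  PLift (I.fst ≤ x ∧ x ≤ I.snd) → k

/-- The structure maps of the interval representation `𝕀[b, d]`: the identity of `k` between
vertices in `[b, d]`, and `0` otherwise. -/
def intervalMap (k : Type u) [Field k] (I : NonemptyInterval (Fin n)) (x y : Fin n) :
    IntervalSpace k I x →ₗ[k] IntervalSpace k I y :=
  LinearMap.pi fun _ : PLift (I.fst ≤ y ∧ y ≤ I.snd) =>
    if hx : I.fst ≤ x ∧ x ≤ I.snd then LinearMap.proj (R := k) (φ := fun _ => k) ⟨hx⟩ else 0

lemma intervalMap_self (I : NonemptyInterval (Fin n)) (x : Fin n) :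
    intervalMap k I x x = LinearMap.id := by
  refine LinearMap.ext fun v => funext fun h => ?_
  simp [intervalMap, h.down]

lemma intervalMap_comp (I : NonemptyInterval (Fin n)) {x y z : Fin n} (hxy : x ≤ y) (hyz : y ≤ z) :
    intervalMap k I y z ∘ₗ intervalMap k I x y = intervalMap k I x z := by
  refine LinearMap.ext fun v => funext fun h => ?_
  by_cases hx : I.fst ≤ x ∧ x ≤ I.snd
  · have hy : I.fst ≤ y ∧ y ≤ I.snd := ⟨hx.1.trans hxy, hyz.trans h.down.2⟩
    simp [intervalMap, hx, hy]
  · by_cases hy : I.fst ≤ y ∧ y ≤ I.snd <;> simp [intervalMap, hx, hy]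

variable (k) in
/-- The interval representation `𝕀[b, d]`, where `I = [b, d]`. -/
def intervalRep (I : NonemptyInterval (Fin n)) : Rep k n where
  obj x := FGModuleCat.of k (IntervalSpace k I x)
  map {x y} _ := FGModuleCat.ofHom (intervalMap k I x y)
  map_id x := FGModuleCat.hom_ext (intervalMap_self I x)
  map_comp f g := FGModuleCat.hom_ext (intervalMap_comp I (leOfHom f) (leOfHom g)).symm

/-- A barcode, i.e. a finite multiset of intervals `[b, d]` with `1 ≤ b ≤ d ≤ n`, given by its
multiplicity function `m(b, d)`. -/
abbrev Barcode (n : ℕ) := NonemptyInterval (Fin n) → ℕ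

/-- The set of bars `(b, d, i)`, `1 ≤ i ≤ m(b, d)`, of a barcode. -/
abbrev Barcode.Bars (B : Barcode n) : Type := Σ I : NonemptyInterval (Fin n), Fin (B I)

attribute [local instance] Abelian.hasFiniteBiproducts in
/-- The property that the multiplicities `m(b, d)` are those of a decomposition
`M ≅ ⨁ 𝕀[b, d] ^ m(b, d)` of `M` into interval representations. -/
def IsBarcodeOf (M : Rep k n) (B : Barcode n) : Prop :=
  Nonempty (M ≅ ⨁ fun x : B.Bars => intervalRep k x.1)

open Classical in
/-- The barcode of a persistence module `M`: the multiplicities in a decomposition of `M` into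
interval representations (which exists by Gabriel's theorem and is unique by the Krull-Schmidt
theorem; the value `0` in the other case is never used). -/
def barcode (M : Rep k n) : Barcode n :=
  if h : ∃ B, IsBarcodeOf M B then h.choose else 0

/-- A `δ`-matching between two barcodes, i.e. a bijection `σ` between a subset `Coim σ` of the
bars of `B` and a subset `Im σ` of the bars of `B'`, such that all bars `[b, d]` of `B` and of `B'`
with `d - b ≥ 2δ` are matched, and such that `b' - δ ≤ b ≤ d ≤ d' + δ` and
`b - δ ≤ b' ≤ d' ≤ d + δ` if `[b, d]` is matched with `[b', d']`. -/
structure IsMatching (δ : ℕ) {B B' : Barcode n} (σ : B.Bars ≃. B'.Bars) : Prop where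
  coim : ∀ x : B.Bars, x.1.fst.val + 2 * δ ≤ x.1.snd.val → ∃ y, y ∈ σ x
  im : ∀ y : B'.Bars, y.1.fst.val + 2 * δ ≤ y.1.snd.val → ∃ x, y ∈ σ x
  fst_le : ∀ x y, y ∈ σ x → y.1.fst.val ≤ x.1.fst.val + δ
  le_snd : ∀ x y, y ∈ σ x → x.1.snd.val ≤ y.1.snd.val + δ
  fst_le' : ∀ x y, y ∈ σ x → x.1.fst.val ≤ y.1.fst.val + δ
  le_snd' : ∀ x y, y ∈ σ x → y.1.snd.val ≤ x.1.snd.val + δ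

/-- Two barcodes are `δ`-matched if there is a `δ`-matching between them. -/
def Matched (δ : ℕ) (B B' : Barcode n) : Prop :=
  ∃ σ : B.Bars ≃. B'.Bars, IsMatching δ σ

/-! ### Derived barcodes -/

/-- A derived barcode: a disjoint union of barcodes indexed by the integers, given as a family. -/
abbrev DerivedBarcode (n : ℕ) := ℤ → Barcode n

/-- Two derived barcodes are `δ`-matched if they are `δ`-matched in each degree. -/
def DerivedMatched (δ : ℕ) (B B' : DerivedBarcode n) : Prop :=
  ∀ i : ℤ, Matched δ (B i) (B' i)

/-- The derived bottleneck distance `d_B^D`: the infimum of the integers `δ ≥ 0` such that the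
derived barcodes are `δ`-matched (`∞` if there are none). -/
def derivedBottleneckDist (B B' : DerivedBarcode n) : ℝ≥0∞ :=
  ⨅ (δ : ℕ) (_ : DerivedMatched δ B B'), (δ : ℝ≥0∞)

/-! ### The bounded derived category of `rep_k A_n`

`D^b(rep_k A_n)` is `DerivedCategory.Bounded (Rep k n)`, the full subcategory of the derived category
(the localization of cochain complexes at the quasi-isomorphisms) on the objects with bounded
cohomology, which are exactly those isomorphic to bounded complexes.  The instance
`HasDerivedCategory (Rep k n)` is the choice of a model of this localization;
`HasDerivedCategory.standard` provides one. -/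

section ExactFunctor

variable {C D : Type*} [Category* C] [Category* D] [Abelian C] [Abelian D]
  (F : C ⥤ D) [F.Additive]
  [PreservesFiniteLimits F] [PreservesFiniteColimits F]

/-- The canonical isomorphism `Hⁱ(F(X)) ≅ F(Hⁱ(X))` on cochain complexes for an exact functor `F`:
the cocycles and the coboundaries of `F(X)` are the images under `F` of those of `X`. -/
def mapComplexHomologyIso (i : ℤ) :
    F.mapHomologicalComplex (ComplexShape.up ℤ) ⋙
        HomologicalComplex.homologyFunctor D (ComplexShape.up ℤ) i ≅
      HomologicalComplex.homologyFunctor C (ComplexShape.up ℤ) i ⋙ F :=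
  NatIso.ofComponents (fun K => (K.sc i).mapHomologyIso F)
    (fun f => ShortComplex.mapHomologyIso_hom_naturality
      ((HomologicalComplex.shortComplexFunctor C (ComplexShape.up ℤ) i).map f) F)

variable [HasDerivedCategory C] [HasDerivedCategory D]

/-- The canonical isomorphism `Hⁱ ∘ F ≅ F ∘ Hⁱ` of functors on the derived category,
for an exact functor `F`. -/
def mapDerivedHomologyIso (i : ℤ) :
    F.mapDerivedCategory ⋙ DerivedCategory.homologyFunctor D i ≅
      DerivedCategory.homologyFunctor C i ⋙ F :=
  letI : Localization.Lifting DerivedCategory.Q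
      (HomologicalComplex.quasiIso C (ComplexShape.up ℤ))
      (F.mapHomologicalComplex (ComplexShape.up ℤ) ⋙
        HomologicalComplex.homologyFunctor D (ComplexShape.up ℤ) i)
      (F.mapDerivedCategory ⋙ DerivedCategory.homologyFunctor D i) :=
    ⟨(Functor.associator _ _ _).symm ≪≫
      Functor.isoWhiskerRight F.mapDerivedCategoryFactors _ ≪≫ Functor.associator _ _ _ ≪≫
      Functor.isoWhiskerLeft _ (DerivedCategory.homologyFunctorFactors D i)⟩
  letI : Localization.Lifting DerivedCategory.Q
      (HomologicalComplex.quasiIso C (ComplexShape.up ℤ))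
      (HomologicalComplex.homologyFunctor C (ComplexShape.up ℤ) i ⋙ F)
      (DerivedCategory.homologyFunctor C i ⋙ F) :=
    ⟨(Functor.associator _ _ _).symm ≪≫
      Functor.isoWhiskerRight (DerivedCategory.homologyFunctorFactors C i) F⟩
  Localization.liftNatIso DerivedCategory.Q
    (HomologicalComplex.quasiIso C (ComplexShape.up ℤ)) _ _ _ _ (mapComplexHomologyIso F i)

/-- An exact functor preserves bounded objects of the derived category. -/
lemma bounded_mapDerivedCategory_obj (X : DerivedCategory C)
    (hX : DerivedCategory.TStructure.t.bounded X) :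
    DerivedCategory.TStructure.t.bounded (F.mapDerivedCategory.obj X) := by
  obtain ⟨⟨a, ha⟩, ⟨b, hb⟩⟩ := hX
  have hZ (i : ℤ) (h : IsZero ((DerivedCategory.homologyFunctor C i).obj X)) :
      IsZero ((DerivedCategory.homologyFunctor D i).obj (F.mapDerivedCategory.obj X)) :=
    (F.map_isZero h).of_iso ((mapDerivedHomologyIso F i).app X)
  have h₁ : (F.mapDerivedCategory.obj X).IsGE a :=
    (DerivedCategory.isGE_iff _ a).2 fun i hi => hZ i (X.isZero_of_isGE a i hi)
  have h₂ : (F.mapDerivedCategory.obj X).IsLE b :=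
    (DerivedCategory.isLE_iff _ b).2 fun i hi => hZ i (X.isZero_of_isLE b i hi)
  exact ⟨⟨a, h₁⟩, ⟨b, h₂⟩⟩

/-- The functor `D^b(C) ⥤ D^b(D)` induced by an exact functor `F : C ⥤ D`, obtained by applying `F`
to the terms and the differentials of complexes. -/
def mapBounded : DerivedCategory.Bounded C ⥤ DerivedCategory.Bounded D :=
  DerivedCategory.TStructure.t.bounded.lift
    (DerivedCategory.Bounded.ι ⋙ F.mapDerivedCategory)
    fun X => bounded_mapDerivedCategory_obj F X.obj X.property

end ExactFunctor

variable [HasDerivedCategory.{w} (Rep k n)]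

variable (k n) in
/-- The `δ`-shift functor `(δ)` on `D^b(rep_k A_n)`. -/
def derivedShift (δ : ℕ) :
    DerivedCategory.Bounded (Rep k n) ⥤ DerivedCategory.Bounded (Rep k n) :=
  mapBounded (shift k n δ)

variable (k n) in
/-- The cohomology functor `Hⁱ : D^b(rep_k A_n) ⥤ rep_k A_n`. -/
def cohomology (i : ℤ) : DerivedCategory.Bounded (Rep k n) ⥤ Rep k n :=
  DerivedCategory.Bounded.ι ⋙ DerivedCategory.homologyFunctor (Rep k n) i

/-- The canonical identification `Hⁱ(X(δ)) ≅ Hⁱ(X)(δ)`. -/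
def cohomologyShiftIso (δ : ℕ) (i : ℤ) (X : DerivedCategory.Bounded (Rep k n)) :
    (cohomology k n i).obj ((derivedShift k n δ).obj X) ≅
      (shift k n δ).obj ((cohomology k n i).obj X) :=
  (mapDerivedHomologyIso (shift k n δ) i).app X.obj

/-- `X` and `Y` in `D^b(rep_k A_n)` are derived `δ`-interleaved if there are morphisms
`f : X ⟶ Y(δ)` and `g : Y ⟶ X(δ)` in `D^b(rep_k A_n)` such that `(Hⁱ(f), Hⁱ(g))` is a
`δ`-interleaving pair between `Hⁱ(X)` and `Hⁱ(Y)` for all `i`. -/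
def DerivedInterleaved (δ : ℕ) (X Y : DerivedCategory.Bounded (Rep k n)) : Prop :=
  ∃ (f : X ⟶ (derivedShift k n δ).obj Y) (g : Y ⟶ (derivedShift k n δ).obj X), ∀ i : ℤ,
    IsInterleavingPair δ
      ((cohomology k n i).map f ≫ (cohomologyShiftIso δ i Y).hom)
      ((cohomology k n i).map g ≫ (cohomologyShiftIso δ i X).hom)

/-- The derived interleaving distance `d_I^D(X, Y)`: the infimum of the integers `δ ≥ 0` such that
`X` and `Y` are derived `δ`-interleaved (`∞` if there are none). -/
def derivedInterleavingDist (X Y : DerivedCategory.Bounded (Rep k n)) : ℝ≥0∞ :=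
  ⨅ (δ : ℕ) (_ : DerivedInterleaved δ X Y), (δ : ℝ≥0∞)

/-- The derived barcode of `X` in `D^b(rep_k A_n)`: the disjoint union over `i` of the barcodes of
the cohomologies `Hⁱ(X)`. -/
def derivedBarcode (X : DerivedCategory.Bounded (Rep k n)) : DerivedBarcode n :=
  fun i => barcode ((cohomology k n i).obj X)

end

end DerivedPersistence

/-!
For each `δ`, the objects `X` and `Y` are derived `δ`-interleaved if and only if their derived
barcodes are `δ`-matched (`derivedMatched_iff_derivedInterleaved`); the two distances are infima
over the same set.

A derived interleaving induces interleavings of the cohomology modules by definition.  Conversely,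
interleavings of the cohomology modules come from a derived interleaving, because `rep_k A_n` has
projective resolutions of length one (`hasTwoTermResolutions`): a complex is then quasi-isomorphic
to the direct sum of the shifted resolutions of its cohomology, so that every family of morphisms
between the cohomology objects is induced by a morphism in the derived category
(`exists_hom_homologyFunctor_map_eq`).  This reduces the theorem to the isometry theorem for single
persistence modules.

Every persistence module is a direct sum of interval representations
(`exists_intervalDecomposition`): a nonzero vector at the first vertex where the module does not
vanish generates an interval summand.  A matching then gives an interleaving by the canonical
morphisms between the matched summands (`exists_isInterleavingPair_of_matched`).  In the other
direction (`matched_of_isInterleavingPair`), the components of an interleaving pair `f`, `g` between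
interval summands are scalars, and the composite is the transition morphism.  Ordering the bars
`[b, d]` of `M` with `d - b ≥ 2δ` by `b + d`, the product of the matrices of `f` and `g` is
unitriangular even when one sums only over the bars of `N` that are `δ`-close to one of the bars
considered.  This is a rank estimate that yields Hall's condition
(`exists_injective_of_shiftComp_eq`), so these bars of `M` can be matched, and so can those of `N`.
The Mendelsohn-Dulmage theorem (`exists_pequiv_of_injective`) combines the two matchings into one.
-/

/-! ### Lifting morphisms between cohomology objects to the derived category -/

namespace DerivedPersistence

section Lifting

universe v u'

variable {C : Type u'} [Category.{v} C] [Abelian C]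

section SplitComplex

variable {P₀ P₁ : ℤ → C} (p : ∀ j, P₁ j ⟶ P₀ j)

/-- The direct sum over `j` of the two-term complexes `p j : P₁ j ⟶ P₀ j`, placed in the degrees
`j - 1` and `j`, as a single cochain complex: in degree `j` it is `P₀ j ⊞ P₁ (j + 1)`. -/
noncomputable def splitComplex : CochainComplex C ℤ :=
  CochainComplex.of (fun j => P₀ j ⊞ P₁ (j + 1))
    (fun j => biprod.snd ≫ p (j + 1) ≫ biprod.inl)
    (fun j => by simp)

variable (j : ℤ)

/-- The inclusion of `P₀ j` in degree `j`. -/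
noncomputable def splitComplexInl : P₀ j ⟶ (splitComplex p).X j :=
  (biprod.inl : P₀ j ⟶ P₀ j ⊞ P₁ (j + 1))

/-- The inclusion of `P₁ (j + 1)` in degree `j`. -/
noncomputable def splitComplexInr : P₁ (j + 1) ⟶ (splitComplex p).X j :=
  (biprod.inr : P₁ (j + 1) ⟶ P₀ j ⊞ P₁ (j + 1))

/-- The projection onto `P₀ j` in degree `j`. -/
noncomputable def splitComplexFst : (splitComplex p).X j ⟶ P₀ j :=
  (biprod.fst : P₀ j ⊞ P₁ (j + 1) ⟶ P₀ j)

/-- The projection onto `P₁ (j + 1)` in degree `j`. -/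
noncomputable def splitComplexSnd : (splitComplex p).X j ⟶ P₁ (j + 1) :=
  (biprod.snd : P₀ j ⊞ P₁ (j + 1) ⟶ P₁ (j + 1))

@[simp]
lemma splitComplexInl_fst : splitComplexInl p j ≫ splitComplexFst p j = 𝟙 _ :=
  biprod.inl_fst

@[simp]
lemma splitComplexInl_snd : splitComplexInl p j ≫ splitComplexSnd p j = 0 :=
  biprod.inl_snd

@[simp]
lemma splitComplexInr_snd : splitComplexInr p j ≫ splitComplexSnd p j = 𝟙 _ :=
  biprod.inr_snd

variable {p j} in
lemma splitComplex_hom_ext {Z : C} {f g : (splitComplex p).X j ⟶ Z}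
    (h₁ : splitComplexInl p j ≫ f = splitComplexInl p j ≫ g)
    (h₂ : splitComplexInr p j ≫ f = splitComplexInr p j ≫ g) : f = g :=
  biprod.hom_ext' _ _ h₁ h₂

lemma splitComplex_total :
    splitComplexFst p j ≫ splitComplexInl p j + splitComplexSnd p j ≫ splitComplexInr p j = 𝟙 _ :=
  biprod.total

lemma splitComplex_d :
    (splitComplex p).d j (j + 1) =
      splitComplexSnd p j ≫ p (j + 1) ≫ splitComplexInl p (j + 1) :=
  CochainComplex.of_d (fun j => P₀ j ⊞ P₁ (j + 1))
    (fun j => biprod.snd ≫ p (j + 1) ≫ biprod.inl) j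

lemma splitComplexInl_d : splitComplexInl p j ≫ (splitComplex p).d j (j + 1) = 0 := by
  rw [splitComplex_d, reassoc_of% (splitComplexInl_snd p j), zero_comp]

/-- The summand `P₀ j` consists of cocycles. -/
noncomputable def splitComplexCocycle : P₀ j ⟶ (splitComplex p).cycles j :=
  (splitComplex p).liftCycles (splitComplexInl p j) (j + 1) (by simp) (splitComplexInl_d p j)

lemma comp_splitComplexCocycle_homologyπ :
    p j ≫ splitComplexCocycle p j ≫ (splitComplex p).homologyπ j = 0 := by
  obtain ⟨i, rfl⟩ : ∃ i, j = i + 1 := ⟨j - 1, by simp⟩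
  have h : p (i + 1) ≫ splitComplexCocycle p (i + 1) =
      splitComplexInr p i ≫ (splitComplex p).toCycles i (i + 1) := by
    rw [← cancel_mono ((splitComplex p).iCycles (i + 1)), Category.assoc, Category.assoc,
      HomologicalComplex.toCycles_i, splitComplexCocycle, HomologicalComplex.liftCycles_i,
      splitComplex_d, reassoc_of% (splitComplexInr_snd p i)]
  rw [reassoc_of% h, HomologicalComplex.toCycles_comp_homologyπ, comp_zero]

/-- If the `p j` are monomorphisms, the cocycles in degree `j` are exactly `P₀ j`. -/
instance epi_splitComplexCocycle [∀ j, Mono (p j)] : Epi (splitComplexCocycle p j) := by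
  have hmono : Mono (splitComplexInl p (j + 1)) := mono_of_mono_fac (splitComplexInl_fst p (j + 1))
  have h0 : (splitComplex p).iCycles j ≫ splitComplexSnd p j = 0 := by
    have := (splitComplex p).iCycles_d j (j + 1)
    rw [splitComplex_d] at this
    rw [← cancel_mono (p (j + 1)), ← cancel_mono (splitComplexInl p (j + 1)), zero_comp,
      zero_comp, Category.assoc, Category.assoc, this]
  have h1 : ((splitComplex p).iCycles j ≫ splitComplexFst p j) ≫ splitComplexInl p j =
      (splitComplex p).iCycles j := by
    have := (splitComplex p).iCycles j ≫= splitComplex_total p j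
    rw [Preadditive.comp_add, reassoc_of% h0, zero_comp, add_zero, Category.comp_id] at this
    rw [Category.assoc, this]
  have : IsSplitEpi (splitComplexCocycle p j) :=
    ⟨⟨⟨(splitComplex p).iCycles j ≫ splitComplexFst p j, by
      rw [← cancel_mono ((splitComplex p).iCycles j), Category.assoc, splitComplexCocycle,
        HomologicalComplex.liftCycles_i, h1, Category.id_comp]⟩⟩⟩
  infer_instance

/-- A family of morphisms `coker (p j) ⟶ Hʲ(K)`, given by their restrictions `a j` to `P₀ j`, is
induced by a morphism of complexes: lift `a j` to the cocycles, and then the restriction to `P₁ j`,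
which is a coboundary, along the differential of `K`. -/
lemma exists_splitComplex_hom [∀ j, Projective (P₀ j)] [∀ j, Projective (P₁ j)]
    (K : CochainComplex C ℤ) (a : ∀ j, P₀ j ⟶ K.homology j) (ha : ∀ j, p j ≫ a j = 0) :
    ∃ φ : splitComplex p ⟶ K, ∀ j, splitComplexCocycle p j ≫ (splitComplex p).homologyπ j ≫
      HomologicalComplex.homologyMap φ j = a j := by
  let u (j : ℤ) : P₀ j ⟶ K.cycles j := Projective.factorThru (a j) (K.homologyπ j)
  have hu (j : ℤ) : u j ≫ K.homologyπ j = a j := Projective.factorThru_comp _ _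
  have hv (j : ℤ) : ∃ v : P₁ (j + 1) ⟶ K.X j,
      v ≫ K.toCycles j (j + 1) = p (j + 1) ≫ u (j + 1) := by
    let S := ShortComplex.mk (K.toCycles j (j + 1)) (K.homologyπ (j + 1)) (by simp)
    have hS : S.Exact := S.exact_of_g_is_cokernel (K.homologyIsCokernel j (j + 1) (by simp))
    exact ⟨hS.liftFromProjective (p (j + 1) ≫ u (j + 1)) (by simp [S, hu, ha]),
      hS.liftFromProjective_comp _ _⟩
  choose v hv using hv
  have hv' (j : ℤ) : v j ≫ K.d j (j + 1) = p (j + 1) ≫ u (j + 1) ≫ K.iCycles (j + 1) := by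
    rw [← reassoc_of% (hv j), HomologicalComplex.toCycles_i]
  let φ' (j : ℤ) : (splitComplex p).X j ⟶ K.X j :=
    (biprod.desc (u j ≫ K.iCycles j) (v j) : P₀ j ⊞ P₁ (j + 1) ⟶ K.X j)
  have hl (j : ℤ) : splitComplexInl p j ≫ φ' j = u j ≫ K.iCycles j := biprod.inl_desc _ _
  have hr (j : ℤ) : splitComplexInr p j ≫ φ' j = v j := biprod.inr_desc _ _
  let φ : splitComplex p ⟶ K :=
    { f := φ'
      comm' := by
        rintro i _ rfl
        refine splitComplex_hom_ext ?_ ?_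
        · rw [reassoc_of% (splitComplexInl_d p i), reassoc_of% (hl i)]
          simp
        · rw [splitComplex_d, Category.assoc, Category.assoc, reassoc_of% (splitComplexInr_snd p i),
            hl, reassoc_of% (hr i), hv'] }
  refine ⟨φ, fun j => ?_⟩
  have h : splitComplexCocycle p j ≫ HomologicalComplex.cyclesMap φ j = u j := by
    rw [← cancel_mono (K.iCycles j), Category.assoc, HomologicalComplex.cyclesMap_i,
      splitComplexCocycle, HomologicalComplex.liftCycles_i_assoc, hl]
  rw [HomologicalComplex.homologyπ_naturality, reassoc_of% h, hu]

end SplitComplex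

variable (C) in
/-- Every object has a projective resolution of length at most one. -/
def HasTwoTermResolutions : Prop :=
  ∀ M : C, ∃ (P₀ P₁ : C) (p : P₁ ⟶ P₀) (e : P₀ ⟶ M) (w : p ≫ e = 0),
    Projective P₀ ∧ Projective P₁ ∧ (ShortComplex.mk p e w).ShortExact

section

variable [HasDerivedCategory.{w} C] (K : CochainComplex C ℤ) (j : ℤ)

/-- The cohomology of the image of `K` in the derived category is that of `K`. -/
noncomputable def homologyQIso :
    (DerivedCategory.homologyFunctor C j).obj (DerivedCategory.Q.obj K) ≅ K.homology j :=
  (DerivedCategory.homologyFunctorFactors C j).app K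

lemma homologyFunctor_map_Q {K L : CochainComplex C ℤ} (φ : K ⟶ L) :
    (DerivedCategory.homologyFunctor C j).map (DerivedCategory.Q.map φ) =
      (homologyQIso K j).hom ≫ HomologicalComplex.homologyMap φ j ≫ (homologyQIso L j).inv := by
  rw [← Category.assoc, Iso.eq_comp_inv]
  exact (DerivedCategory.homologyFunctorFactors C j).hom.naturality φ

end

/-- In the derived category of a category in which projective resolutions have length at most one,
every family of morphisms between the cohomology objects comes from a morphism.  Indeed, a complex
`K` is quasi-isomorphic to the direct sum of the shifted resolutions of its cohomology objects, and
this sum maps to any complex `L` inducing a prescribed family of morphisms on cohomology. -/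
theorem exists_hom_homologyFunctor_map_eq [HasDerivedCategory.{w} C]
    (hC : HasTwoTermResolutions C) (X Y : DerivedCategory C)
    (a : ∀ j : ℤ, (DerivedCategory.homologyFunctor C j).obj X ⟶
      (DerivedCategory.homologyFunctor C j).obj Y) :
    ∃ f : X ⟶ Y, ∀ j, (DerivedCategory.homologyFunctor C j).map f = a j := by
  -- reduction to complexes
  suffices H : ∀ (K L : CochainComplex C ℤ) (a : ∀ j : ℤ, K.homology j ⟶ L.homology j),
      ∃ f : DerivedCategory.Q.obj K ⟶ DerivedCategory.Q.obj L, ∀ j,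
        (DerivedCategory.homologyFunctor C j).map f =
          (homologyQIso K j).hom ≫ a j ≫ (homologyQIso L j).inv by
    let eX := DerivedCategory.Q.objObjPreimageIso X
    let eY := DerivedCategory.Q.objObjPreimageIso Y
    obtain ⟨f, hf⟩ := H (DerivedCategory.Q.objPreimage X) (DerivedCategory.Q.objPreimage Y)
      (fun j => (homologyQIso _ j).inv ≫ (DerivedCategory.homologyFunctor C j).map eX.hom ≫ a j ≫
        (DerivedCategory.homologyFunctor C j).map eY.inv ≫ (homologyQIso _ j).hom)
    refine ⟨eX.inv ≫ f ≫ eY.hom, fun j => ?_⟩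
    simp only [Functor.map_comp, hf, Category.assoc, Iso.hom_inv_id_assoc,
      Iso.map_inv_hom_id_assoc, Iso.map_inv_hom_id, Category.comp_id]
  intro K L a
  choose P₀ P₁ p e w hP₀ hP₁ hS using fun j => hC (K.homology j)
  have hp (j : ℤ) : Mono (p j) := (hS j).mono_f
  have he (j : ℤ) : Epi (e j) := (hS j).epi_g
  obtain ⟨φ, hφ⟩ := exists_splitComplex_hom p K e w
  obtain ⟨ψ, hψ⟩ := exists_splitComplex_hom p L (fun j => e j ≫ a j)
    (fun j => by rw [reassoc_of% (w j), zero_comp])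
  have hq : QuasiIso φ := by
    refine (quasiIso_iff φ).2 fun j => (quasiIsoAt_iff_isIso_homologyMap φ j).2 ?_
    -- the inverse of `Hʲ(φ)`: `P₀ j ⟶ Hʲ` kills `P₁ j`, so it factors through the cokernel `Hʲ(K)`
    let s : K.homology j ⟶ (splitComplex p).homology j :=
      (hS j).gIsCokernel.desc (CokernelCofork.ofπ
        (splitComplexCocycle p j ≫ (splitComplex p).homologyπ j)
        (comp_splitComplexCocycle_homologyπ p j))
    have hs : e j ≫ s = splitComplexCocycle p j ≫ (splitComplex p).homologyπ j :=
      (hS j).gIsCokernel.fac _ WalkingParallelPair.one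
    refine ⟨s, ?_, ?_⟩
    · rw [← cancel_epi (splitComplexCocycle p j ≫ (splitComplex p).homologyπ j)]
      simp only [Category.assoc, Category.comp_id]
      rw [reassoc_of% (hφ j), hs]
    · rw [← cancel_epi (e j), reassoc_of% hs, hφ, Category.comp_id]
  have hQ : IsIso (DerivedCategory.Q.map φ) := inferInstance
  refine ⟨inv (DerivedCategory.Q.map φ) ≫ DerivedCategory.Q.map ψ, fun j => ?_⟩
  -- both sides agree after composition with the epimorphism from `P₀ j`
  have hcomp : HomologicalComplex.homologyMap φ j ≫ a j = HomologicalComplex.homologyMap ψ j := by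
    rw [← cancel_epi (splitComplexCocycle p j ≫ (splitComplex p).homologyπ j)]
    simp only [Category.assoc]
    rw [reassoc_of% (hφ j), hψ]
  rw [Functor.map_comp, Functor.map_inv, IsIso.inv_comp_eq, homologyFunctor_map_Q,
    homologyFunctor_map_Q, ← hcomp]
  simp

end Lifting

end DerivedPersistence

/-! ### Morphisms from and to interval representations -/

namespace DerivedPersistence

noncomputable section

variable {k : Type u} [Field k] {n : ℕ}

/-- The component at the vertex `x` of a morphism of persistence modules, as a linear map. -/
abbrev component {M N : Rep k n} (f : M ⟶ N) (x : Fin n) : M.obj x →ₗ[k] N.obj x :=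
  (f.app x).hom.hom

lemma rep_hom_ext {M N : Rep k n} {f g : M ⟶ N}
    (h : ∀ x v, component f x v = component g x v) : f = g :=
  NatTrans.ext (funext fun x => FGModuleCat.hom_ext (LinearMap.ext (h x)))

variable (k) in
/-- The canonical generator of the interval representation `𝕀[b, d]` at the vertex `x`. -/
def intervalOne (I : NonemptyInterval (Fin n)) (x : Fin n) : (intervalRep k I).obj x :=
  (fun _ => 1 : IntervalSpace k I x)

/-- The coordinate of an element of `𝕀[b, d]` at a vertex `x` of `[b, d]`. -/
def intervalCoord {I : NonemptyInterval (Fin n)} {x : Fin n} (hx : I.fst ≤ x ∧ x ≤ I.snd) :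
    (intervalRep k I).obj x →ₗ[k] k :=
  LinearMap.proj (R := k) (φ := fun _ : PLift (I.fst ≤ x ∧ x ≤ I.snd) => k) ⟨hx⟩

@[simp]
lemma intervalCoord_intervalOne {I : NonemptyInterval (Fin n)} {x : Fin n}
    (hx : I.fst ≤ x ∧ x ≤ I.snd) : intervalCoord hx (intervalOne k I x) = 1 :=
  rfl

lemma intervalCoord_structMap {I : NonemptyInterval (Fin n)} {x y : Fin n} (hxy : x ≤ y)
    (hx : I.fst ≤ x ∧ x ≤ I.snd) (hy : I.fst ≤ y ∧ y ≤ I.snd) (v : (intervalRep k I).obj x) :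
    intervalCoord hy (structMap (intervalRep k I) hxy v) = intervalCoord hx v := by
  have h (w : IntervalSpace k I x) : intervalMap k I x y w ⟨hy⟩ = w ⟨hx⟩ := by
    simp [intervalMap, hx]
  exact h v

lemma intervalCoord_structMap_of_not_mem {I : NonemptyInterval (Fin n)} {x y : Fin n}
    (hxy : x ≤ y) (hx : ¬ (I.fst ≤ x ∧ x ≤ I.snd)) (hy : I.fst ≤ y ∧ y ≤ I.snd)
    (v : (intervalRep k I).obj x) :
    intervalCoord hy (structMap (intervalRep k I) hxy v) = 0 := by
  have h (w : IntervalSpace k I x) : intervalMap k I x y w ⟨hy⟩ = 0 := by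
    simp [intervalMap, hx]
  exact h v

/-- An element of `M_b` that vanishes beyond the vertex `d` defines a morphism `𝕀[b, d] ⟶ M`. -/
def ofElement (I : NonemptyInterval (Fin n)) (M : Rep k n) (v : M.obj I.fst)
    (hv : ∀ y (h : I.fst ≤ y), I.snd < y → structMap M h v = 0) : intervalRep k I ⟶ M where
  app x := FGModuleCat.ofHom (V := IntervalSpace k I x) (W := M.obj x) <|
    if hx : I.fst ≤ x ∧ x ≤ I.snd then
      LinearMap.toSpanSingleton k (M.obj x) (structMap M hx.1 v) ∘ₗ
        LinearMap.proj (R := k) (φ := fun _ => k) ⟨hx⟩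
    else 0
  naturality x y f := by
    refine FGModuleCat.hom_ext (LinearMap.ext fun w => ?_)
    change IntervalSpace k I x at w
    have hxy : x ≤ y := leOfHom f
    change (dite _ _ _ : IntervalSpace k I y →ₗ[k] M.obj y) (intervalMap k I x y w) =
      structMap M hxy ((dite _ _ _ : IntervalSpace k I x →ₗ[k] M.obj x) w)
    by_cases hx : I.fst ≤ x ∧ x ≤ I.snd
    · by_cases hy : y ≤ I.snd
      · have hy' : I.fst ≤ y ∧ y ≤ I.snd := ⟨hx.1.trans hxy, hy⟩
        rw [dif_pos hx, dif_pos hy']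
        simp [intervalMap, hx, structMap_structMap]
      · rw [dif_pos hx, dif_neg fun h => hy h.2]
        simp [structMap_structMap, hv y (hx.1.trans hxy) (not_le.1 hy)]
    · by_cases hy : I.fst ≤ y ∧ y ≤ I.snd
      · rw [dif_neg hx, dif_pos hy]
        simp [intervalMap, hx]
      · rw [dif_neg hx, dif_neg hy]
        simp

lemma ofElement_apply_one {I : NonemptyInterval (Fin n)} {M : Rep k n} {v : M.obj I.fst}
    (hv : ∀ y (h : I.fst ≤ y), I.snd < y → structMap M h v = 0) {x : Fin n}
    (hx : I.fst ≤ x ∧ x ≤ I.snd) :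
    component (ofElement I M v hv) x (intervalOne k I x) = structMap M hx.1 v := by
  change (dite _ _ _ : IntervalSpace k I x →ₗ[k] M.obj x) _ = _
  rw [dif_pos hx]
  exact one_smul k _

lemma structMap_intervalOne (I : NonemptyInterval (Fin n)) {x y : Fin n} (hxy : x ≤ y)
    (hx : I.fst ≤ x ∧ x ≤ I.snd) :
    structMap (intervalRep k I) hxy (intervalOne k I x) = intervalOne k I y := by
  change intervalMap k I x y (fun _ => 1) = _
  ext h
  simp [intervalMap, hx, intervalOne]

lemma intervalRep_obj_ext {I : NonemptyInterval (Fin n)} {x : Fin n}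
    {v w : (intervalRep k I).obj x}
    (h : ∀ hx : I.fst ≤ x ∧ x ≤ I.snd, intervalCoord hx v = intervalCoord hx w) : v = w :=
  funext fun hx => h hx.down

lemma intervalRep_obj_eq_zero {I : NonemptyInterval (Fin n)} {x : Fin n}
    (hx : ¬ (I.fst ≤ x ∧ x ≤ I.snd)) (v : (intervalRep k I).obj x) : v = 0 :=
  intervalRep_obj_ext fun h => absurd h hx

lemma intervalOne_ne_zero {I : NonemptyInterval (Fin n)} {x : Fin n}
    (hx : I.fst ≤ x ∧ x ≤ I.snd) : intervalOne k I x ≠ 0 := fun h => by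
  have := intervalCoord_intervalOne (k := k) hx
  rw [h, map_zero] at this
  exact zero_ne_one this

lemma intervalRep_obj_eq_smul {I : NonemptyInterval (Fin n)} {x : Fin n}
    (hx : I.fst ≤ x ∧ x ≤ I.snd) (v : (intervalRep k I).obj x) :
    v = intervalCoord hx v • intervalOne k I x :=
  intervalRep_obj_ext fun _ => (mul_one _).symm

/-- A morphism from an interval representation is determined by the image of the generator at the
left end. -/
lemma intervalRep_hom_ext {I : NonemptyInterval (Fin n)} {M : Rep k n} {f g : intervalRep k I ⟶ M}
    (h : component f I.fst (intervalOne k I I.fst) = component g I.fst (intervalOne k I I.fst)) :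
    f = g := by
  refine rep_hom_ext fun x v => ?_
  by_cases hx : I.fst ≤ x ∧ x ≤ I.snd
  · rw [intervalRep_obj_eq_smul hx v, map_smul, map_smul,
      ← structMap_intervalOne I hx.1 ⟨le_rfl, I.fst_le_snd⟩]
    congr 1
    exact (app_structMap f hx.1 _).trans ((congrArg _ h).trans (app_structMap g hx.1 _).symm)
  · rw [intervalRep_obj_eq_zero hx v, map_zero, map_zero]

/-- A linear form on `M_d` that vanishes on the images of the spaces `M_x`, `x < b`, defines a
morphism `M ⟶ 𝕀[b, d]`. -/
def ofFunctional (I : NonemptyInterval (Fin n)) (M : Rep k n) (l : M.obj I.snd →ₗ[k] k)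
    (hl : ∀ x (h : x ≤ I.snd), x < I.fst → l ∘ₗ structMap M h = 0) : M ⟶ intervalRep k I where
  app x := FGModuleCat.ofHom (V := M.obj x) (W := IntervalSpace k I x) <|
    LinearMap.pi fun hx => l ∘ₗ structMap M hx.down.2
  naturality x y f := by
    refine FGModuleCat.hom_ext (LinearMap.ext fun w => funext fun hy => ?_)
    have hxy : x ≤ y := leOfHom f
    change l (structMap M hy.down.2 (structMap M hxy w)) =
      intervalMap k I x y (fun hx => l (structMap M hx.down.2 w)) hy
    rw [structMap_structMap]
    by_cases hx : I.fst ≤ x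
    · simp [intervalMap, hx, hxy.trans hy.down.2]
    · simpa [intervalMap, hx] using congr($(hl x (hxy.trans hy.down.2) (not_le.1 hx)) w)

lemma ofFunctional_apply {I : NonemptyInterval (Fin n)} {M : Rep k n} {l : M.obj I.snd →ₗ[k] k}
    (hl : ∀ x (h : x ≤ I.snd), x < I.fst → l ∘ₗ structMap M h = 0) {x : Fin n} (v : M.obj x)
    (hx : I.fst ≤ x ∧ x ≤ I.snd) :
    intervalCoord hx (component (ofFunctional I M l hl) x v) = l (structMap M hx.2 v) :=
  rfl

end

end DerivedPersistence

/-! ### Decomposition into interval representations -/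

namespace DerivedPersistence

noncomputable section

variable {k : Type u} [Field k] {n : ℕ}

lemma app_mono_injective {M N : Rep k n} (f : M ⟶ N) [Mono f] (x : Fin n) :
    Function.Injective (component f x) := by
  have h : Mono (f.app x) := inferInstance
  have h' : Mono ((forget₂ (FGModuleCat k) (ModuleCat k)).map (f.app x)) := inferInstance
  exact (ModuleCat.mono_iff_injective _).1 h'

lemma app_epi_surjective {M N : Rep k n} (f : M ⟶ N) [Epi f] (x : Fin n) :
    Function.Surjective (component f x) := by
  have h : Epi (f.app x) := inferInstance
  have h' : Epi ((forget₂ (FGModuleCat k) (ModuleCat k)).map (f.app x)) := inferInstance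
  exact (ModuleCat.epi_iff_surjective _).1 h'

/-- A nonzero persistence module has an interval summand: take `b` the first vertex with `M_b ≠ 0`,
any nonzero `v ∈ M_b`, and `d` the last vertex at which the image of `v` does not vanish.  A linear
form on `M_d` with value `1` at the image of `v` gives the retraction. -/
lemma exists_retract_interval (M : Rep k n) {x : Fin n} (v₀ : M.obj x) (hv₀ : v₀ ≠ 0) :
    ∃ (I : NonemptyInterval (Fin n)) (i : intervalRep k I ⟶ M) (r : M ⟶ intervalRep k I),
      i ≫ r = 𝟙 _ := by
  classical
  obtain ⟨b, ⟨v, hv⟩, hb⟩ : ∃ b, (∃ v : M.obj b, v ≠ 0) ∧ ∀ y < b, ∀ w : M.obj y, w = 0 := by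
    have h : ∃ b, ∃ v : M.obj b, v ≠ 0 := ⟨x, v₀, hv₀⟩
    obtain ⟨b, hb, hmin⟩ := WellFounded.has_min (wellFounded_lt (α := Fin n))
      {b | ∃ v : M.obj b, v ≠ 0} h
    exact ⟨b, hb, fun y hy w => by_contra fun hw => hmin y ⟨w, hw⟩ hy⟩
  obtain ⟨d, ⟨hbd, hd⟩, hmax⟩ : ∃ d, (∃ h : b ≤ d, structMap M h v ≠ 0) ∧
      ∀ y (h : b ≤ y), d < y → structMap M h v = 0 := by
    obtain ⟨d, hd, hmax⟩ := WellFounded.has_min (wellFounded_gt (α := Fin n))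
      {d | ∃ h : b ≤ d, structMap M h v ≠ 0} ⟨b, le_rfl, by rwa [structMap_refl]⟩
    exact ⟨d, hd, fun y h hy => by_contra fun hw => hmax y ⟨h, hw⟩ hy⟩
  obtain ⟨l, hl⟩ : ∃ l : M.obj d →ₗ[k] k, l (structMap M hbd v) = 1 := by
    obtain ⟨l, hl⟩ := not_forall.1 (mt (Module.forall_dual_apply_eq_zero_iff k _).1 hd)
    exact ⟨(l (structMap M hbd v))⁻¹ • l, inv_mul_cancel₀ hl⟩
  let I : NonemptyInterval (Fin n) := ⟨⟨b, d⟩, hbd⟩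
  refine ⟨I, ofElement I M v hmax, ofFunctional I M l fun y h hy => ?_, ?_⟩
  · exact LinearMap.ext fun w => by rw [hb y hy w, map_zero, map_zero]
  · refine intervalRep_hom_ext (intervalRep_obj_ext fun hx => ?_)
    have hl' : ∀ y (h : y ≤ I.snd), y < I.fst → l ∘ₗ structMap M h = 0 := fun y h hy =>
      LinearMap.ext fun w => by rw [hb y hy w, map_zero, LinearMap.zero_apply]
    change intervalCoord hx (component (ofFunctional I M l hl') b
      (component (ofElement I M v hmax) b (intervalOne k I b))) = 1
    rw [ofElement_apply_one hmax (I := I) ⟨le_rfl, hbd⟩, ofFunctional_apply, structMap_refl]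
    exact hl

/-- The total dimension of a persistence module. -/
def totalDim (M : Rep k n) : ℕ := ∑ x, Module.finrank k (M.obj x)

lemma totalDim_lt_of_mono {M N : Rep k n} (f : M ⟶ N) [Mono f] {x : Fin n}
    (hx : ¬ Function.Surjective (component f x)) : totalDim M < totalDim N := by
  refine Finset.sum_lt_sum (fun y _ => LinearMap.finrank_le_finrank_of_injective
    (app_mono_injective f y)) ⟨x, Finset.mem_univ x, ?_⟩
  refine lt_of_le_of_ne (LinearMap.finrank_le_finrank_of_injective (app_mono_injective f x))
    fun h => hx ?_
  exact (LinearMap.injective_iff_surjective_of_finrank_eq_finrank h).1 (app_mono_injective f x)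

attribute [local instance] Abelian.hasFiniteBiproducts

/-- A decomposition of `M` into the interval representations given by a finite family, by its
inclusions and projections. -/
structure IntervalDecomposition (M : Rep k n) {ι : Type} [Fintype ι]
    (I : ι → NonemptyInterval (Fin n)) where
  inc (a : ι) : intervalRep k (I a) ⟶ M
  prj (a : ι) : M ⟶ intervalRep k (I a)
  inc_prj_self (a : ι) : inc a ≫ prj a = 𝟙 _
  inc_prj_of_ne (a b : ι) (h : a ≠ b) : inc a ≫ prj b = 0
  total : ∑ a, prj a ≫ inc a = 𝟙 M

namespace IntervalDecomposition

variable {M : Rep k n} {ι : Type} [Fintype ι] {I : ι → NonemptyInterval (Fin n)}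

/-- The decomposition given by an isomorphism to a biproduct. -/
def ofIso (e : M ≅ ⨁ fun a => intervalRep k (I a)) : IntervalDecomposition M I where
  inc a := biproduct.ι (fun a => intervalRep k (I a)) a ≫ e.inv
  prj a := e.hom ≫ biproduct.π (fun a => intervalRep k (I a)) a
  inc_prj_self a := by simp
  inc_prj_of_ne a b h := by simp [biproduct.ι_π_ne _ h]
  total := by
    have := biproduct.total (f := fun a => intervalRep k (I a))
    rw [← cancel_epi e.inv, ← cancel_mono e.hom]
    simp [Preadditive.comp_sum, Preadditive.sum_comp, this]

lemma sum_component (D : IntervalDecomposition M I) {x : Fin n} (v : M.obj x) :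
    ∑ a, component (D.inc a) x (component (D.prj a) x v) = v := by
  let ev : (M ⟶ M) →+ M.obj x :=
    { toFun := fun f => component f x v
      map_zero' := rfl
      map_add' := fun _ _ => rfl }
  exact (map_sum ev _ _).symm.trans (congrArg ev D.total)

/-- The isomorphism to a biproduct given by a decomposition. -/
def iso (D : IntervalDecomposition M I) : M ≅ ⨁ fun a => intervalRep k (I a) where
  hom := biproduct.lift D.prj
  inv := biproduct.desc D.inc
  hom_inv_id := by rw [biproduct.lift_desc, D.total]
  inv_hom_id := by
    classical
    refine biproduct.hom_ext' _ _ fun a => biproduct.hom_ext _ _ fun b => ?_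
    by_cases h : a = b
    · subst h
      simp [D.inc_prj_self]
    · simp [D.inc_prj_of_ne a b h, biproduct.ι_π_ne _ h]

/-- A decomposition of the kernel of a split epimorphism `M ⟶ 𝕀[b, d]` is completed to a
decomposition of `M`. -/
def ofRetract (J : NonemptyInterval (Fin n)) (i : intervalRep k J ⟶ M) (r : M ⟶ intervalRep k J)
    (hir : i ≫ r = 𝟙 _) (D : IntervalDecomposition (kernel r) I) :
    IntervalDecomposition M (fun a : Option ι => a.elim J I) :=
  let q : M ⟶ kernel r := kernel.lift r (𝟙 M - r ≫ i) (by simp [hir])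
  have hq : q ≫ kernel.ι r = 𝟙 M - r ≫ i := kernel.lift_ι _ _ _
  have hιq : kernel.ι r ≫ q = 𝟙 _ := by simp [← cancel_mono (kernel.ι r), hq]
  have hiq : i ≫ q = 0 := by simp [← cancel_mono (kernel.ι r), hq, reassoc_of% hir]
  { inc := fun a => match a with
      | none => i
      | some a => D.inc a ≫ kernel.ι r
    prj := fun a => match a with
      | none => r
      | some a => q ≫ D.prj a
    inc_prj_self := fun a => match a with
      | none => hir
      | some a => by
        change (D.inc a ≫ kernel.ι r) ≫ q ≫ D.prj a = 𝟙 _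
        rw [Category.assoc, reassoc_of% hιq, D.inc_prj_self]
    inc_prj_of_ne := fun a b h => match a, b with
      | none, none => absurd rfl h
      | none, some b => by
        change i ≫ q ≫ D.prj b = 0
        rw [reassoc_of% hiq, zero_comp]
      | some a, none => by
        change (D.inc a ≫ kernel.ι r) ≫ r = 0
        rw [Category.assoc, kernel.condition, comp_zero]
      | some a, some b => by
        change (D.inc a ≫ kernel.ι r) ≫ q ≫ D.prj b = 0
        rw [Category.assoc, reassoc_of% hιq, D.inc_prj_of_ne _ _ fun hab => h (congrArg some hab)]
    total := by
      have h : ∑ a, (q ≫ D.prj a) ≫ D.inc a ≫ kernel.ι r = q ≫ kernel.ι r := by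
        have := q ≫= (D.total =≫ kernel.ι r)
        rw [Category.id_comp, Preadditive.sum_comp, Preadditive.comp_sum] at this
        simpa only [Category.assoc] using this
      rw [Fintype.sum_option]
      refine (congrArg (r ≫ i + ·) h).trans ?_
      rw [hq, add_sub_cancel] }

end IntervalDecomposition

lemma exists_isBarcodeOf_of_iso {M : Rep k n} {ι : Type} [Fintype ι]
    (I : ι → NonemptyInterval (Fin n)) (e : M ≅ ⨁ fun i => intervalRep k (I i)) :
    ∃ B, IsBarcodeOf M B := by
  classical
  let B : Barcode n := fun J => Fintype.card {i // I i = J}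
  let σ : ι ≃ B.Bars := (Equiv.sigmaFiberEquiv I).symm.trans
    (Equiv.sigmaCongrRight fun J => Fintype.equivFin {i // I i = J})
  exact ⟨B, ⟨e ≪≫ biproduct.whiskerEquiv (f := fun i => intervalRep k (I i))
    (g := fun x : B.Bars => intervalRep k x.1) σ fun i => Iso.refl (intervalRep k (I i))⟩⟩

/-- **Gabriel's theorem** for the equioriented quiver of type `A`: split off interval summands, by
induction on the total dimension. -/
theorem exists_intervalDecomposition (M : Rep k n) :
    ∃ (ι : Type) (_ : Fintype ι) (I : ι → NonemptyInterval (Fin n)),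
      Nonempty (IntervalDecomposition M I) := by
  induction h : totalDim M using Nat.strong_induction_on generalizing M with
  | _ N ih =>
  by_cases hM : ∀ (x : Fin n) (v : M.obj x), v = 0
  · have hM0 : 𝟙 M = 0 := rep_hom_ext fun x v => by rw [hM x v, map_zero, map_zero]
    exact ⟨Empty, inferInstance, Empty.elim,
      ⟨⟨fun a => a.elim, fun a => a.elim, fun a => a.elim, fun a => a.elim, hM0.symm⟩⟩⟩
  · push Not at hM
    obtain ⟨x, v, hv⟩ := hM
    obtain ⟨I, i, r, hir⟩ := exists_retract_interval M v hv
    have hlt : totalDim (kernel r) < totalDim M := by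
      refine totalDim_lt_of_mono (kernel.ι r) (x := I.fst) fun hs => ?_
      obtain ⟨w, hw⟩ := hs (component i I.fst (intervalOne k I I.fst))
      have h1 : component r I.fst (component i I.fst (intervalOne k I I.fst)) =
          intervalOne k I I.fst := congr(component $hir I.fst (intervalOne k I I.fst))
      have h2 : component r I.fst (component (kernel.ι r) I.fst w) = 0 :=
        congr(component $(kernel.condition r) I.fst w)
      rw [hw, h1] at h2
      exact intervalOne_ne_zero ⟨le_rfl, I.fst_le_snd⟩ h2
    obtain ⟨ι, hι, J, ⟨D⟩⟩ := ih _ (h ▸ hlt) (kernel r) rfl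
    exact ⟨Option ι, inferInstance, _, ⟨.ofRetract I i r hir D⟩⟩

lemma isBarcodeOf_barcode (M : Rep k n) : IsBarcodeOf M (barcode M) := by
  obtain ⟨ι, hι, I, ⟨D⟩⟩ := exists_intervalDecomposition M
  have h := exists_isBarcodeOf_of_iso I D.iso
  rw [barcode, dif_pos h]
  exact h.choose_spec

/-- A decomposition of `M` into the bars of its barcode. -/
def barcodeDecomposition (M : Rep k n) :
    IntervalDecomposition M fun x : (barcode M).Bars => x.1 :=
  .ofIso (isBarcodeOf_barcode M).some

/-! ### Projective resolutions of length one -/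

/-- The interval representation `𝕀[b, n]` is projective: it represents the functor `M ↦ M_b`. -/
lemma projective_intervalRep (I : NonemptyInterval (Fin n)) (hI : ∀ y, y ≤ I.snd) :
    Projective (intervalRep k I) where
  factors {E X} f e he := by
    obtain ⟨v, hv⟩ := app_epi_surjective e I.fst (component f I.fst (intervalOne k I I.fst))
    refine ⟨ofElement I E v fun y _ h => absurd (hI y) (not_le.2 h), intervalRep_hom_ext ?_⟩
    change component e I.fst (component (ofElement I E v _) I.fst (intervalOne k I I.fst)) = _
    rw [ofElement_apply_one _ ⟨le_rfl, I.fst_le_snd⟩, structMap_refl, hv]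

lemma projective_biproduct {C : Type*} [Category* C] [Preadditive C] {ι : Type*} (P : ι → C)
    [HasBiproduct P] [∀ a, Projective (P a)] : Projective (⨁ P) where
  factors f e _ := ⟨biproduct.desc fun a => Projective.factorThru (biproduct.ι P a ≫ f) e,
    biproduct.hom_ext' _ _ fun a => by simp⟩

/-- A persistence module with injective structure maps is projective, because the intervals of a
decomposition all extend to the last vertex. -/
lemma projective_of_injective (M : Rep k n)
    (hM : ∀ (x y : Fin n) (h : x ≤ y), Function.Injective (structMap M h)) : Projective M := by
  obtain ⟨ι, hι, I, ⟨D⟩⟩ := exists_intervalDecomposition M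
  have hI (a : ι) : Projective (intervalRep k (I a)) := by
    refine projective_intervalRep _ fun y => not_lt.1 fun hy => ?_
    have hb : (I a).fst ≤ y := (I a).fst_le_snd.trans hy.le
    have h1 : structMap M hb (component (D.inc a) _ (intervalOne k (I a) (I a).fst)) = 0 := by
      rw [← app_structMap, intervalRep_obj_eq_zero (fun h => not_le.2 hy h.2)
        (structMap (intervalRep k (I a)) hb _), map_zero]
    have h2 : component (D.inc a) _ (intervalOne k (I a) (I a).fst) = 0 :=
      hM _ _ hb (h1.trans (map_zero _).symm)
    have h3 : intervalOne k (I a) (I a).fst = 0 := by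
      have := congr(component $(D.inc_prj_self a) _ (intervalOne k (I a) (I a).fst))
      rw [← show _ = intervalOne k (I a) (I a).fst from this]
      exact (congrArg (component (D.prj a) _) h2).trans (map_zero _)
    exact intervalOne_ne_zero ⟨le_rfl, (I a).fst_le_snd⟩ h3
  exact Projective.of_iso D.iso.symm (projective_biproduct _)

/-- The last vertex of the quiver, given some vertex. -/
def lastVertex (x : Fin n) : Fin n := ⟨n - 1, by have := x.isLt; omega⟩

lemma le_lastVertex (x y : Fin n) : y ≤ lastVertex x := by
  have := y.isLt
  exact Fin.le_def.2 (by simp only [lastVertex]; omega)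

lemma IntervalDecomposition.injective_structMap {M : Rep k n} {ι : Type} [Fintype ι]
    {I : ι → NonemptyInterval (Fin n)} (D : IntervalDecomposition M I) {x y : Fin n} (h : x ≤ y)
    (hI : ∀ a, y ≤ (I a).snd) : Function.Injective (structMap M h) := by
  refine (injective_iff_map_eq_zero _).2 fun v hv => ?_
  have hprj (a : ι) : component (D.prj a) x v = 0 := by
    have h0 : structMap (intervalRep k (I a)) h (component (D.prj a) x v) = 0 := by
      rw [← app_structMap, hv, map_zero]
    refine intervalRep_obj_ext fun hx => ?_
    rw [map_zero, ← intervalCoord_structMap h hx ⟨hx.1.trans h, hI a⟩, h0, map_zero]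
  rw [← D.sum_component v]
  exact Finset.sum_eq_zero fun a _ => by rw [hprj, map_zero]

variable (k n) in
/-- Replacing each summand `𝕀[b, d]` of `M` by `𝕀[b, n]` gives an epimorphism from a projective
module onto `M`.  Its kernel inherits injective structure maps, hence is projective too. -/
lemma hasTwoTermResolutions : HasTwoTermResolutions (Rep k n) := by
  intro M
  obtain ⟨ι, hι, I, ⟨D⟩⟩ := exists_intervalDecomposition M
  let J (a : ι) : NonemptyInterval (Fin n) :=
    ⟨⟨(I a).fst, lastVertex (I a).fst⟩, le_lastVertex (I a).fst _⟩
  have hJl (a : ι) (y : Fin n) : y ≤ (J a).snd := le_lastVertex (I a).fst y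
  have he' (a : ι) (y) (h : (J a).fst ≤ y) (hy : (J a).snd < y) :
      structMap (intervalRep k (I a)) h (intervalOne k (I a) (I a).fst) = 0 :=
    absurd (hJl a y) (not_le.2 hy)
  let e (a : ι) : intervalRep k (J a) ⟶ intervalRep k (I a) :=
    ofElement (J a) _ (intervalOne k (I a) (I a).fst) (he' a)
  have hJ (a : ι) : Projective (intervalRep k (J a)) :=
    projective_intervalRep _ (hJl a)
  have he (a : ι) : Epi (e a) := ⟨fun g h hgh => intervalRep_hom_ext <| by
    have h1 : component (e a) (I a).fst (intervalOne k (J a) (I a).fst) =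
        intervalOne k (I a) (I a).fst :=
      (ofElement_apply_one (he' a) ⟨le_rfl, (J a).fst_le_snd⟩).trans (structMap_refl _ _ _)
    rw [← h1]
    exact congr(component $hgh (I a).fst (intervalOne k (J a) (I a).fst))⟩
  let π : (⨁ fun a => intervalRep k (J a)) ⟶ M := biproduct.map e ≫ D.iso.inv
  have hπ : Epi π := epi_comp _ _
  refine ⟨_, _, kernel.ι π, π, kernel.condition π, projective_biproduct _,
    projective_of_injective _ fun x y h => ?_, ⟨ShortComplex.exact_kernel π⟩⟩
  let D' : IntervalDecomposition (⨁ fun a => intervalRep k (J a)) J := .ofIso (Iso.refl _)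
  refine .of_comp (f := component (kernel.ι π) y) ?_
  have hc : component (kernel.ι π) y ∘ structMap (kernel π) h =
      structMap (⨁ fun a => intervalRep k (J a)) h ∘ component (kernel.ι π) x :=
    funext (app_structMap (kernel.ι π) h)
  rw [hc]
  exact (D'.injective_structMap h fun a => hJl a _).comp (app_mono_injective _ _)

end

end DerivedPersistence

/-! ### Morphisms from interval representations to shifted ones -/

namespace DerivedPersistence

noncomputable section

variable {k : Type u} [Field k] {n : ℕ}

/-- The component of an element of `M(δ)_x` in `M_{x + δ}`. -/
abbrev shiftCoord (δ : ℕ) (M : Rep k n) (x : Fin n) (h : x.val + δ < n) :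
    ((shift k n δ).obj M).obj x →ₗ[k] M.obj ⟨x.val + δ, h⟩ :=
  shiftProj δ M x h

lemma shift_obj_ext {δ : ℕ} {M : Rep k n} {x : Fin n} {v w : ((shift k n δ).obj M).obj x}
    (h : ∀ hx, shiftCoord δ M x hx v = shiftCoord δ M x hx w) : v = w :=
  funext fun hx => h hx.down

lemma shiftCoord_structMap {δ : ℕ} {M : Rep k n} {x y : Fin n} (hxy : x ≤ y) (hy : y.val + δ < n)
    (v : ((shift k n δ).obj M).obj x) :
    shiftCoord δ M y hy (structMap ((shift k n δ).obj M) hxy v) =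
      structMap M (s := ⟨x.val + δ, (Nat.add_le_add_right hxy δ).trans_lt hy⟩)
        (t := ⟨y.val + δ, hy⟩) (Nat.add_le_add_right hxy δ)
        (shiftCoord δ M x ((Nat.add_le_add_right hxy δ).trans_lt hy) v) :=
  rfl

lemma shiftCoord_transition {δ : ℕ} {M : Rep k n} {x : Fin n} (hx : x.val + δ < n) (v : M.obj x) :
    shiftCoord δ M x hx (component (transition δ M) x v) =
      structMap M (t := ⟨x.val + δ, hx⟩) (Nat.le_add_right x.val δ) v :=
  rfl

/-- The composite `g(δ) ∘ f : L ⟶ N(2δ)` of `f : L ⟶ M(δ)` and `g : M ⟶ N(δ)`. -/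
def shiftComp {δ : ℕ} {L M N : Rep k n} (f : L ⟶ (shift k n δ).obj M)
    (g : M ⟶ (shift k n δ).obj N) : L ⟶ (shift k n (2 * δ)).obj N :=
  f ≫ (shift k n δ).map g ≫ (shiftShiftIso δ N).hom

lemma shiftCoord_shiftComp {δ : ℕ} {L M N : Rep k n} (f : L ⟶ (shift k n δ).obj M)
    (g : M ⟶ (shift k n δ).obj N) {x : Fin n} (hx : x.val + 2 * δ < n) (v : L.obj x) :
    shiftCoord (2 * δ) N x hx (component (shiftComp f g) x v) =
      structMap N (s := ⟨x.val + δ + δ, by omega⟩) (t := ⟨x.val + 2 * δ, hx⟩)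
        (Fin.mk_le_mk.2 (by omega))
        (shiftCoord δ N ⟨x.val + δ, by omega⟩ (by simp only; omega)
          (component g ⟨x.val + δ, by omega⟩ (shiftCoord δ M x (by omega) (component f x v)))) :=
  rfl

section

variable {δ : ℕ} {L M N : Rep k n}

lemma comp_shiftComp {L' : Rep k n} (h : L' ⟶ L) (f : L ⟶ (shift k n δ).obj M)
    (g : M ⟶ (shift k n δ).obj N) : h ≫ shiftComp f g = shiftComp (h ≫ f) g :=
  (Category.assoc _ _ _).symm

lemma shiftComp_comp {N' : Rep k n} (f : L ⟶ (shift k n δ).obj M)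
    (g : M ⟶ (shift k n δ).obj N) (h : N ⟶ N') :
    shiftComp f g ≫ (shift k n (2 * δ)).map h = shiftComp f (g ≫ (shift k n δ).map h) :=
  rep_hom_ext fun _ _ => shift_obj_ext fun _ => app_structMap h _ _

lemma shiftComp_middle {M' : Rep k n} (f : L ⟶ (shift k n δ).obj M) (h : M ⟶ M')
    (g : M' ⟶ (shift k n δ).obj N) :
    shiftComp (f ≫ (shift k n δ).map h) g = shiftComp f (h ≫ g) :=
  rfl

lemma transition_naturality (h : M ⟶ N) :
    h ≫ transition δ N = transition δ M ≫ (shift k n δ).map h :=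
  rep_hom_ext fun _ _ => shift_obj_ext fun _ => (app_structMap h _ _).symm

lemma shiftComp_sum {ι : Type*} (s : Finset ι) (f : ι → (L ⟶ (shift k n δ).obj M))
    (g : M ⟶ (shift k n δ).obj N) : shiftComp (∑ a ∈ s, f a) g = ∑ a ∈ s, shiftComp (f a) g :=
  Preadditive.sum_comp _ _ _

@[simp]
lemma zero_shiftComp (g : M ⟶ (shift k n δ).obj N) : shiftComp (0 : L ⟶ _) g = 0 :=
  zero_comp

end

/-- The generator of `𝕀[b, d](δ)` at the vertex `x`. -/
def shiftIntervalOne (k : Type u) [Field k] (δ : ℕ) (J : NonemptyInterval (Fin n)) (x : Fin n) :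
    ((shift k n δ).obj (intervalRep k J)).obj x :=
  (fun _ => intervalOne k J _ : ShiftSpace δ (intervalRep k J) x)

lemma structMap_shiftIntervalOne {δ : ℕ} {I J : NonemptyInterval (Fin n)}
    (h : J.snd.val ≤ I.snd.val + δ) (y : Fin n) (hIy : I.fst ≤ y) (hy : I.snd < y) :
    structMap ((shift k n δ).obj (intervalRep k J)) hIy (shiftIntervalOne k δ J I.fst) = 0 := by
  refine shift_obj_ext fun hx => intervalRep_obj_ext fun hJ => ?_
  have h₁ : y.val + δ ≤ J.snd.val := hJ.2
  have h₂ : I.snd.val < y.val := hy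
  omega

/-- The canonical morphism `𝕀[b, d] ⟶ 𝕀[b', d'](δ)`, where `d' ≤ d + δ`, mapping generators to
generators. -/
def canonicalHom (k : Type u) [Field k] {δ : ℕ} {I J : NonemptyInterval (Fin n)}
    (h : J.snd.val ≤ I.snd.val + δ) :
    intervalRep k I ⟶ (shift k n δ).obj (intervalRep k J) :=
  ofElement I _ (shiftIntervalOne k δ J I.fst) (structMap_shiftIntervalOne h)

/-- The canonical morphisms between two intervals whose ends differ by at most `δ` compose to the
transition morphism.  If `b + 2δ ≤ d`, all the vertices involved lie in the intervals;
otherwise both morphisms send the generator at `b` to a zero space. -/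
lemma shiftComp_canonicalHom {δ : ℕ} {I J : NonemptyInterval (Fin n)}
    (h₁ : J.fst.val ≤ I.fst.val + δ) (h₂ : J.snd.val ≤ I.snd.val + δ)
    (h₃ : I.fst.val ≤ J.fst.val + δ) (h₄ : I.snd.val ≤ J.snd.val + δ) :
    shiftComp (canonicalHom k h₂) (canonicalHom k h₄) = transition (2 * δ) (intervalRep k I) := by
  refine intervalRep_hom_ext (shift_obj_ext fun hx => ?_)
  by_cases h : I.fst.val + 2 * δ ≤ I.snd.val
  · have hJ : J.fst ≤ ⟨I.fst.val + δ, by omega⟩ ∧ ⟨I.fst.val + δ, by omega⟩ ≤ J.snd := by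
      constructor <;> refine Fin.le_def.2 ?_ <;> simp only <;> omega
    have hI : I.fst ≤ ⟨J.fst.val + δ, by omega⟩ ∧ ⟨J.fst.val + δ, by omega⟩ ≤ I.snd := by
      constructor <;> refine Fin.le_def.2 ?_ <;> simp only <;> omega
    have hI' : I.fst ≤ ⟨I.fst.val + δ + δ, by omega⟩ ∧ ⟨I.fst.val + δ + δ, by omega⟩ ≤ I.snd := by
      constructor <;> refine Fin.le_def.2 ?_ <;> simp only <;> omega
    have e₁ : shiftCoord δ (intervalRep k J) I.fst (by omega)
        (component (canonicalHom k h₂) I.fst (intervalOne k I I.fst)) = intervalOne k J _ := by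
      rw [canonicalHom, ofElement_apply_one _ ⟨le_rfl, I.fst_le_snd⟩, structMap_refl]
      rfl
    have e₂ : shiftCoord δ (intervalRep k I) ⟨I.fst.val + δ, by omega⟩ (by simp only; omega)
        (component (canonicalHom k h₄) ⟨I.fst.val + δ, by omega⟩ (intervalOne k J _)) =
        intervalOne k I _ := by
      rw [canonicalHom, ofElement_apply_one _ hJ, shiftCoord_structMap]
      exact structMap_intervalOne I _ hI
    rw [shiftCoord_shiftComp, e₁, e₂, structMap_intervalOne I _ hI', shiftCoord_transition,
      structMap_intervalOne I _ ⟨le_rfl, I.fst_le_snd⟩]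
  · refine intervalRep_obj_ext fun hI => absurd (Fin.le_def.1 hI.2) h

lemma transition_intervalRep_eq_zero {δ : ℕ} {I : NonemptyInterval (Fin n)}
    (h : I.snd.val < I.fst.val + δ) : transition δ (intervalRep k I) = 0 :=
  intervalRep_hom_ext <| shift_obj_ext fun _ => intervalRep_obj_ext fun hI =>
    absurd (Fin.le_def.1 hI.2) (not_le.2 h)

/-- The coefficient of a morphism `𝕀[b, d] ⟶ 𝕀[b', d'](δ)` with respect to the generators
at the vertices `b` and `b + δ` (zero if `b + δ` does not lie in `[b', d']`). -/
def coeff {δ : ℕ} {I J : NonemptyInterval (Fin n)} :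
    (intervalRep k I ⟶ (shift k n δ).obj (intervalRep k J)) →+ k where
  toFun f :=
    if h : J.fst.val ≤ I.fst.val + δ ∧ I.fst.val + δ ≤ J.snd.val then
      intervalCoord h (shiftCoord δ (intervalRep k J) I.fst (h.2.trans_lt J.snd.isLt)
        (component f I.fst (intervalOne k I I.fst)))
    else 0
  map_zero' := by
    split_ifs with h
    · exact map_zero (intervalCoord h)
    · rfl
  map_add' f g := by
    split_ifs with h
    · exact map_add (intervalCoord h) _ _
    · exact (add_zero 0).symm

section coeff

variable {δ : ℕ} {I J K : NonemptyInterval (Fin n)}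

lemma coeff_of_mem (f : intervalRep k I ⟶ (shift k n δ).obj (intervalRep k J))
    (h₁ : J.fst.val ≤ I.fst.val + δ) (h₂ : I.fst.val + δ ≤ J.snd.val) :
    coeff f = intervalCoord ⟨h₁, h₂⟩ (shiftCoord δ (intervalRep k J) I.fst
      (h₂.trans_lt J.snd.isLt) (component f I.fst (intervalOne k I I.fst))) :=
  dif_pos ⟨h₁, h₂⟩

/-- The last inequality holds since the generator of `𝕀[b, d]` dies after `d`, so its image in
`𝕀[b', d'](δ)` cannot live longer. -/
lemma le_of_coeff_ne_zero {f : intervalRep k I ⟶ (shift k n δ).obj (intervalRep k J)}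
    (hf : coeff f ≠ 0) :
    J.fst.val ≤ I.fst.val + δ ∧ I.fst.val + δ ≤ J.snd.val ∧ J.snd.val ≤ I.snd.val + δ := by
  have h : J.fst.val ≤ I.fst.val + δ ∧ I.fst.val + δ ≤ J.snd.val :=
    by_contra fun h => hf (dif_neg h)
  refine ⟨h.1, h.2, not_lt.1 fun hlt => hf ?_⟩
  have hJ := J.snd.isLt
  have hI : I.fst.val ≤ I.snd.val := I.fst_le_snd
  let y : Fin n := ⟨I.snd.val + 1, by omega⟩
  have hIy : I.fst ≤ y := Fin.le_def.2 (by simp only [y]; omega)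
  have hy : ¬ (I.fst ≤ y ∧ y ≤ I.snd) := fun h => by
    have := Fin.le_def.1 h.2
    simp only [y] at this
    omega
  have hyn : y.val + δ < n := by simp only [y]; omega
  have hyJ : J.fst ≤ ⟨y.val + δ, hyn⟩ ∧ ⟨y.val + δ, hyn⟩ ≤ J.snd := by
    constructor <;> refine Fin.le_def.2 ?_ <;> simp only [y] <;> omega
  rw [coeff_of_mem f h.1 h.2, ← intervalCoord_structMap (y := ⟨y.val + δ, hyn⟩)
    (Nat.add_le_add_right hIy δ) _ hyJ, ← shiftCoord_structMap hIy hyn, ← app_structMap,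
    intervalRep_obj_eq_zero hy (structMap _ _ _), map_zero, map_zero, map_zero]

/-- Coefficients are multiplicative as long as `b + 2δ` lies in the target interval, i.e. unless the
generator is sent to a zero space. -/
lemma coeff_shiftComp (f : intervalRep k I ⟶ (shift k n δ).obj (intervalRep k J))
    (g : intervalRep k J ⟶ (shift k n δ).obj (intervalRep k K))
    (h₁ : K.fst.val ≤ I.fst.val + 2 * δ) (h₂ : I.fst.val + 2 * δ ≤ K.snd.val) :
    coeff (shiftComp f g) = coeff f * coeff g := by
  have hK := K.snd.isLt
  have hKδ : K.fst ≤ ⟨I.fst.val + δ + δ, by omega⟩ ∧ ⟨I.fst.val + δ + δ, by omega⟩ ≤ K.snd := by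
    constructor <;> refine Fin.le_def.2 ?_ <;> simp only <;> omega
  rw [coeff_of_mem _ h₁ h₂, shiftCoord_shiftComp, intervalCoord_structMap _ hKδ]
  by_cases h : J.fst.val ≤ I.fst.val + δ ∧ I.fst.val + δ ≤ J.snd.val
  · have hJx : J.fst ≤ ⟨I.fst.val + δ, by omega⟩ := h.1
    rw [intervalRep_obj_eq_smul (I := J) h (shiftCoord δ _ _ _ _), ← coeff_of_mem f h.1 h.2,
      map_smul, map_smul, map_smul, smul_eq_mul,
      ← structMap_intervalOne J hJx ⟨le_rfl, J.fst_le_snd⟩, app_structMap, shiftCoord_structMap]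
    congr 1
    by_cases h' : K.fst.val ≤ J.fst.val + δ ∧ J.fst.val + δ ≤ K.snd.val
    · rw [intervalCoord_structMap _ h', coeff_of_mem g h'.1 h'.2]
    · rw [intervalCoord_structMap_of_not_mem _ h']
      have : coeff g = 0 := dif_neg h'
      rw [this]
  · rw [intervalRep_obj_eq_zero (I := J) h (shiftCoord δ _ _ _ _), map_zero, map_zero, map_zero]
    have : coeff f = 0 := dif_neg h
    rw [this, zero_mul]

lemma coeff_transition (h : I.fst.val + δ ≤ I.snd.val) :
    coeff (transition δ (intervalRep k I)) = 1 := by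
  rw [coeff_of_mem _ (Nat.le_add_right _ _) h, shiftCoord_transition,
    intervalCoord_structMap _ ⟨le_rfl, I.fst_le_snd⟩, intervalCoord_intervalOne]

end coeff

end

end DerivedPersistence

/-! ### Matchings in bipartite graphs -/

namespace DerivedPersistence

section Matchings

/-- If the product of `F` and `G` through `t` is unitriangular with respect to `α`, i.e. its
diagonal entries are `1` and its entries at `x ≠ x'` with `α x ≤ α x'` vanish, then `s` is not larger than
`t`. -/
lemma card_le_card_of_sum_mul_eq {k U V : Type*} [Field k] (s : Finset U) (t : Finset V)
    (F : U → V → k) (G : V → U → k) (α : U → ℕ)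
    (h₁ : ∀ x ∈ s, ∑ y ∈ t, F x y * G y x = 1)
    (h₀ : ∀ x ∈ s, ∀ x' ∈ s, x ≠ x' → α x ≤ α x' → ∑ y ∈ t, F x y * G y x' = 0) :
    s.card ≤ t.card := by
  by_contra! hlt
  let φ : (s → k) →ₗ[k] (t → k) := Matrix.vecMulLinear (Matrix.of fun (x : s) (y : t) => F x y)
  obtain ⟨c, hc, hc0⟩ : ∃ c : s → k, φ c = 0 ∧ c ≠ 0 := by
    have hk : LinearMap.ker φ ≠ ⊥ := LinearMap.ker_ne_bot_of_finrank_lt (by simpa using hlt)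
    exact (Submodule.ne_bot_iff _).1 hk
  have hφ (y : t) : ∑ x : s, c x * F x y = 0 := congrFun hc y
  have hsum (x' : s) : ∑ x : s, c x * ∑ y ∈ t, F x y * G y x' = 0 := by
    simp_rw [← Finset.sum_coe_sort t, Finset.mul_sum, ← mul_assoc]
    rw [Finset.sum_comm]
    simp_rw [← Finset.sum_mul, hφ, zero_mul, Finset.sum_const_zero]
  -- a member of the support of `c` on which `α` is maximal
  obtain ⟨x', hx', hmax⟩ : ∃ x' : s, c x' ≠ 0 ∧ ∀ x : s, c x ≠ 0 → α x ≤ α x' := by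
    classical
    obtain ⟨x₀, hx₀⟩ := Function.ne_iff.1 hc0
    obtain ⟨x', hx', hmax⟩ := Finset.exists_max_image (Finset.univ.filter fun x : s => c x ≠ 0)
      (fun x => α x) ⟨x₀, by simpa using hx₀⟩
    exact ⟨x', by simpa using hx', fun x hx => hmax x (by simpa using hx)⟩
  refine hx' ?_
  rw [← hsum x', Finset.sum_eq_single x', h₁ x' x'.2, mul_one]
  · intro x _ hx
    by_cases hcx : c x = 0
    · rw [hcx, zero_mul]
    · rw [h₀ x x.2 x' x'.2 (fun h => hx (Subtype.ext h)) (hmax x hcx), mul_zero]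
  · exact fun h => absurd (Finset.mem_univ _) h

/-- If `F * G` is unitriangular with respect to `α`, and each nonzero term `F x y * G y x'` with
`α x ≤ α x'` has `y` related to `x` or to `x'`, then `R` contains an injective function.  Hall's
condition for a set `s` holds because the product stays unitriangular on `s` when the sums are
restricted to the elements related to a member of `s`. -/
lemma exists_injective_of_sum_mul_eq {k U V : Type*} [Field k] [Finite U] [Fintype V]
    (F : U → V → k) (G : V → U → k) (α : U → ℕ) (R : U → V → Prop)
    (h₁ : ∀ x, ∑ y, F x y * G y x = 1)
    (h₀ : ∀ x x', x ≠ x' → α x ≤ α x' → ∑ y, F x y * G y x' = 0)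
    (hR : ∀ x x' y, α x ≤ α x' → F x y * G y x' ≠ 0 → R x y ∨ R x' y) :
    ∃ m : U → V, Function.Injective m ∧ ∀ x, R x (m x) := by
  classical
  have hall := Finset.all_card_le_biUnion_card_iff_exists_injective
    (fun x => Finset.univ.filter (R x))
  simp only [Finset.mem_filter, Finset.mem_univ, true_and] at hall
  refine hall.1 fun s => ?_
  have hsub (x x' : U) (hx : x ∈ s) (hx' : x' ∈ s) (hα : α x ≤ α x') :
      ∑ y ∈ s.biUnion fun x => Finset.univ.filter (R x), F x y * G y x' =
        ∑ y, F x y * G y x' := by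
    refine Finset.sum_subset (Finset.subset_univ _) fun y _ hy => by_contra fun h => hy ?_
    rcases hR x x' y hα h with h' | h'
    · exact Finset.mem_biUnion.2 ⟨x, hx, by simpa using h'⟩
    · exact Finset.mem_biUnion.2 ⟨x', hx', by simpa using h'⟩
  refine card_le_card_of_sum_mul_eq s _ F G α (fun x hx => ?_) fun x hx x' hx' hne hα => ?_
  · rw [hsub x x hx hx le_rfl, h₁]
  · rw [hsub x x' hx hx' hα, h₀ x x' hne hα]

/-- The elements of `U` on the alternating paths `u, a u, b (a u), …` that begin at an element
outside the image of `b`. -/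
inductive AlternatingReachable {U V : Type*} {p : U → Prop} {q : V → Prop} (a : Subtype p → V)
    (b : Subtype q → U) : U → Prop
  | base (u : U) (hu : ∀ v, b v ≠ u) : AlternatingReachable a b u
  | step (u : Subtype p) (v : Subtype q) (h : a u = v) (hu : AlternatingReachable a b u) :
      AlternatingReachable a b (b v)

/-- **Mendelsohn-Dulmage theorem**: if a matching in a bipartite graph covers all `u` with `p u` and
another one covers all `v` with `q v`, then some matching covers all of these.  As in the proof of
the Schröder-Bernstein theorem, use `a` on the alternating paths that begin in `U` outside the image
of `b`, and `b` elsewhere. -/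
theorem exists_pequiv_of_injective {U V : Type*} {p : U → Prop} {q : V → Prop} {R : U → V → Prop}
    (a : Subtype p → V) (ha : Function.Injective a) (haR : ∀ u : Subtype p, R u (a u))
    (b : Subtype q → U) (hb : Function.Injective b) (hbR : ∀ v : Subtype q, R (b v) v) :
    ∃ σ : U ≃. V, (∀ u, p u → ∃ v, v ∈ σ u) ∧ (∀ v, q v → ∃ u, v ∈ σ u) ∧
      ∀ u v, v ∈ σ u → R u v := by
  classical
  let S := AlternatingReachable a b
  let m (u : U) (v : V) : Prop := (S u ∧ ∃ hu : p u, a ⟨u, hu⟩ = v) ∨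
    (¬ S u ∧ ∃ hv : q v, b ⟨v, hv⟩ = u)
  have hm₁ {u v v'} (h : m u v) (h' : m u v') : v = v' := by
    rcases h with ⟨hS, hu, rfl⟩ | ⟨hS, hv, hvu⟩ <;>
      rcases h' with ⟨hS', hu', rfl⟩ | ⟨hS', hv', hvu'⟩
    · rfl
    · exact absurd hS hS'
    · exact absurd hS' hS
    · exact congrArg Subtype.val (hb (hvu.trans hvu'.symm))
  have hm₂ {u u' v} (h : m u v) (h' : m u' v) : u = u' := by
    rcases h with ⟨hS, hu, huv⟩ | ⟨hS, hv, rfl⟩ <;>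
      rcases h' with ⟨hS', hu', huv'⟩ | ⟨hS', hv', rfl⟩
    · exact congrArg Subtype.val (ha (huv.trans huv'.symm))
    · exact absurd (.step ⟨u, hu⟩ ⟨v, hv'⟩ huv hS) hS'
    · exact absurd (.step ⟨u', hu'⟩ ⟨v, hv⟩ huv' hS') hS
    · rfl
  let σ : U ≃. V :=
    -- the choices are unique by `hm₁` and `hm₂`
    { toFun := fun u => if h : ∃ v, m u v then some h.choose else none
      invFun := fun v => if h : ∃ u, m u v then some h.choose else none
      inv := fun u v => by
        have h₁ : u ∈ (if h : ∃ u, m u v then some h.choose else none) ↔ m u v := by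
          split_ifs with h
          · rw [Option.mem_some_iff]
            exact ⟨fun e => e ▸ h.choose_spec, fun e => hm₂ h.choose_spec e⟩
          · simpa using fun e => h ⟨u, e⟩
        have h₂ : v ∈ (if h : ∃ v, m u v then some h.choose else none) ↔ m u v := by
          split_ifs with h
          · rw [Option.mem_some_iff]
            exact ⟨fun e => e ▸ h.choose_spec, fun e => hm₁ h.choose_spec e⟩
          · simpa using fun e => h ⟨v, e⟩
        exact h₁.trans h₂.symm }
  have hσ {u v} : v ∈ σ u ↔ m u v := by
    change v ∈ (if h : ∃ v, m u v then some h.choose else none) ↔ m u v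
    split_ifs with h
    · rw [Option.mem_some_iff]
      exact ⟨fun e => e ▸ h.choose_spec, fun e => hm₁ h.choose_spec e⟩
    · simpa using fun e => h ⟨v, e⟩
  refine ⟨σ, fun u hu => ?_, fun v hv => ?_, fun u v h => ?_⟩
  · by_cases hS : S u
    · exact ⟨a ⟨u, hu⟩, hσ.2 (.inl ⟨hS, hu, rfl⟩)⟩
    · have : ∃ v, b v = u := by
        by_contra! h
        exact hS (.base u h)
      obtain ⟨v, hv⟩ := this
      exact ⟨v, hσ.2 (.inr ⟨hS, v.2, hv⟩)⟩
  · by_cases hS : S (b ⟨v, hv⟩)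
    · generalize hu : b ⟨v, hv⟩ = u at hS
      rcases hS with ⟨_, h⟩ | ⟨w, v', hw, hSw⟩
      · exact absurd hu (h _)
      · exact ⟨w, hσ.2 (.inl ⟨hSw, w.2, hw.trans (congrArg Subtype.val (hb hu)).symm⟩)⟩
    · exact ⟨_, hσ.2 (.inr ⟨hS, hv, rfl⟩)⟩
  · rcases hσ.1 h with ⟨-, hu, rfl⟩ | ⟨-, hv, rfl⟩
    · exact haR ⟨u, hu⟩
    · exact hbR ⟨v, hv⟩

end Matchings

end DerivedPersistence

namespace DerivedPersistence

noncomputable section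

variable {k : Type u} [Field k] {n : ℕ}

/-! ### Matchings from interleavings -/

section Stability

variable {δ : ℕ} {M N : Rep k n} {U V : Type} [Fintype U] [Fintype V]
  {I : U → NonemptyInterval (Fin n)} {J : V → NonemptyInterval (Fin n)}

lemma IntervalDecomposition.sum_shiftComp (E : IntervalDecomposition N J) {L L' : Rep k n}
    (f : L ⟶ (shift k n δ).obj N) (g : N ⟶ (shift k n δ).obj L') :
    ∑ y, shiftComp (f ≫ (shift k n δ).map (E.prj y)) (E.inc y ≫ g) = shiftComp f g := by
  have h (y : V) : shiftComp (f ≫ (shift k n δ).map (E.prj y)) (E.inc y ≫ g) =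
      shiftComp (f ≫ (shift k n δ).map (E.prj y ≫ E.inc y)) g := by
    rw [shiftComp_middle, shiftComp_middle, Category.assoc]
  simp_rw [h]
  rw [← shiftComp_sum, ← Preadditive.comp_sum, ← Functor.map_sum, E.total,
    CategoryTheory.Functor.map_id, Category.comp_id]

/-- If `g(δ) ∘ f` is the transition morphism, then the matrices of coefficients of `f` and `g`
multiply to the matrix of the transition morphism, at the entries where the composite of the
components can be read off at the vertex `b + 2δ`. -/
lemma sum_coeff_mul_coeff (D : IntervalDecomposition M I) (E : IntervalDecomposition N J)
    {f : M ⟶ (shift k n δ).obj N} {g : N ⟶ (shift k n δ).obj M}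
    (hfg : shiftComp f g = transition (2 * δ) M) {x x' : U}
    (h₁ : (I x').fst.val ≤ (I x).fst.val + 2 * δ) (h₂ : (I x).fst.val + 2 * δ ≤ (I x').snd.val) :
    ∑ y, coeff ((D.inc x ≫ f) ≫ (shift k n δ).map (E.prj y)) *
        coeff (E.inc y ≫ g ≫ (shift k n δ).map (D.prj x')) =
      coeff ((D.inc x ≫ D.prj x') ≫ transition (2 * δ) (intervalRep k (I x'))) := by
  simp_rw [← coeff_shiftComp _ _ h₁ h₂]
  rw [← map_sum, E.sum_shiftComp (D.inc x ≫ f) (g ≫ (shift k n δ).map (D.prj x')),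
    ← shiftComp_comp, ← comp_shiftComp, hfg, Category.assoc, Category.assoc, transition_naturality]

/-- The ends of the intervals differ by at most `δ`: the inequalities between two bars matched by a
`δ`-matching. -/
def CloseIntervals (δ : ℕ) (I J : NonemptyInterval (Fin n)) : Prop :=
  (J.fst.val ≤ I.fst.val + δ ∧ I.snd.val ≤ J.snd.val + δ) ∧
    I.fst.val ≤ J.fst.val + δ ∧ J.snd.val ≤ I.snd.val + δ

/-- The bars of `M` with `d - b ≥ 2δ` can be matched injectively with bars of `N`: with
`α [b, d] = b + d`, the product of the coefficient matrices of `f` and `g` is unitriangular on these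
bars, and if
`[b, d] → J → [b', d']` has nonzero coefficients and `α [b, d] ≤ α [b', d']`, then `J` is
`δ`-close to `[b, d]` or to `[b', d']`. -/
theorem exists_injective_of_shiftComp_eq (D : IntervalDecomposition M I)
    (E : IntervalDecomposition N J)
    {f : M ⟶ (shift k n δ).obj N} {g : N ⟶ (shift k n δ).obj M}
    (hfg : shiftComp f g = transition (2 * δ) M) :
    ∃ m : {x // (I x).fst.val + 2 * δ ≤ (I x).snd.val} → V,
      Function.Injective m ∧ ∀ x : Subtype _, CloseIntervals δ (I x) (J (m x)) := by
  let F (x : U) (y : V) : k := coeff ((D.inc x ≫ f) ≫ (shift k n δ).map (E.prj y))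
  let G (y : V) (x : U) : k := coeff (E.inc y ≫ g ≫ (shift k n δ).map (D.prj x))
  have hF {x y} (h : F x y ≠ 0) := le_of_coeff_ne_zero h
  have hG {y x} (h : G y x ≠ 0) := le_of_coeff_ne_zero h
  refine exists_injective_of_sum_mul_eq (k := k)
    (U := {x // (I x).fst.val + 2 * δ ≤ (I x).snd.val}) (fun x y => F x y) (fun y x => G y x)
    (fun x => (I x).fst.val + (I x).snd.val) (fun x y => CloseIntervals δ (I x) (J y)) ?_ ?_ ?_
  · rintro ⟨x, hx⟩
    rw [sum_coeff_mul_coeff D E hfg (Nat.le_add_right _ _) hx, D.inc_prj_self, Category.id_comp,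
      coeff_transition hx]
  · rintro ⟨x, hx⟩ ⟨x', hx'⟩ hne hα
    by_cases h : (I x').fst.val ≤ (I x).fst.val + 2 * δ ∧ (I x).fst.val + 2 * δ ≤ (I x').snd.val
    · rw [sum_coeff_mul_coeff D E hfg h.1 h.2, D.inc_prj_of_ne _ _ fun e => hne (Subtype.ext e),
        zero_comp, map_zero]
    -- nonzero coefficients force `b' ≤ b + 2δ`; as `b' + 2δ ≤ d'`, the inequality
    -- `d' < b + 2δ` would give `d' < d` and `b' < b`, against `hα`
    · refine Finset.sum_eq_zero fun y _ => by_contra fun h0 => h ?_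
      have h₁ := hF (x := x) (y := y) (left_ne_zero_of_mul h0)
      have h₂ := hG (y := y) (x := x') (right_ne_zero_of_mul h0)
      simp only at hα
      omega
  · rintro ⟨x, hx⟩ ⟨x', hx'⟩ y hα h0
    have h₁ := hF (x := x) (y := y) (left_ne_zero_of_mul h0)
    have h₂ := hG (y := y) (x := x') (right_ne_zero_of_mul h0)
    simp only [CloseIntervals] at hα ⊢
    omega

/-- **Algebraic stability**: interleaved persistence modules have matched barcodes. -/
theorem matched_of_isInterleavingPair {f : M ⟶ (shift k n δ).obj N}
    {g : N ⟶ (shift k n δ).obj M} (h : IsInterleavingPair δ f g) :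
    Matched δ (barcode M) (barcode N) := by
  obtain ⟨a, ha, haR⟩ := exists_injective_of_shiftComp_eq (barcodeDecomposition M)
    (barcodeDecomposition N) h.1
  obtain ⟨b, hb, hbR⟩ := exists_injective_of_shiftComp_eq (barcodeDecomposition N)
    (barcodeDecomposition M) h.2
  obtain ⟨σ, h₁, h₂, h₃⟩ := exists_pequiv_of_injective
    (R := fun (x : (barcode M).Bars) (y : (barcode N).Bars) => CloseIntervals δ x.1 y.1)
    a ha haR b hb fun v => ⟨(hbR v).2, (hbR v).1⟩
  exact ⟨σ, h₁, h₂, fun x y h => (h₃ x y h).1.1, fun x y h => (h₃ x y h).1.2,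
    fun x y h => (h₃ x y h).2.1, fun x y h => (h₃ x y h).2.2⟩

end Stability

/-! ### Interleavings from matchings -/

section Interleaving

variable {δ : ℕ} {M N : Rep k n} {U V : Type} [Fintype U] [Fintype V]
  {I : U → NonemptyInterval (Fin n)} {J : V → NonemptyInterval (Fin n)}

lemma IntervalDecomposition.hom_ext (D : IntervalDecomposition M I) {f g : M ⟶ N}
    (h : ∀ x, D.inc x ≫ f = D.inc x ≫ g) : f = g := by
  rw [← Category.id_comp f, ← Category.id_comp g, ← D.total, Preadditive.sum_comp,
    Preadditive.sum_comp]
  simp only [Category.assoc, h]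

lemma IntervalDecomposition.exists_hom (D : IntervalDecomposition M I)
    (φ : ∀ x, intervalRep k (I x) ⟶ N) : ∃ f : M ⟶ N, ∀ x, D.inc x ≫ f = φ x := by
  refine ⟨∑ x, D.prj x ≫ φ x, fun x => ?_⟩
  rw [Preadditive.comp_sum, Finset.sum_eq_single x, ← Category.assoc, D.inc_prj_self,
    Category.id_comp]
  · intro y _ hy
    rw [← Category.assoc, D.inc_prj_of_ne _ _ hy.symm, zero_comp]
  · exact fun h => absurd (Finset.mem_univ x) h

/-- A matching induces a morphism `M ⟶ N(δ)`, given on the summands by canonical morphisms. -/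
lemma exists_hom_of_matching (D : IntervalDecomposition M I) (E : IntervalDecomposition N J)
    (σ : U ≃. V) (h : ∀ x y, y ∈ σ x → (J y).snd.val ≤ (I x).snd.val + δ) :
    ∃ f : M ⟶ (shift k n δ).obj N, (∀ x, σ x = none → D.inc x ≫ f = 0) ∧
      ∀ x y (hxy : y ∈ σ x),
        D.inc x ≫ f = canonicalHom k (h x y hxy) ≫ (shift k n δ).map (E.inc y) := by
  have hφ (x : U) : ∃ φ : intervalRep k (I x) ⟶ (shift k n δ).obj N, (σ x = none → φ = 0) ∧
      ∀ y (hxy : y ∈ σ x), φ = canonicalHom k (h x y hxy) ≫ (shift k n δ).map (E.inc y) := by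
    obtain hx | ⟨y, hx⟩ := Option.eq_none_or_eq_some (σ x)
    · exact ⟨0, fun _ => rfl, fun y hy => by simp [hx] at hy⟩
    · refine ⟨canonicalHom k (h x y hx) ≫ (shift k n δ).map (E.inc y), by simp [hx],
        fun y' hy' => ?_⟩
      obtain rfl : y = y' := Option.mem_unique hx hy'
      rfl
  choose φ h₀ h₁ using hφ
  obtain ⟨f, hf⟩ := D.exists_hom φ
  exact ⟨f, fun x hx => (hf x).trans (h₀ x hx), fun x y hxy => (hf x).trans (h₁ x y hxy)⟩

/-- The morphisms induced by a matching form an interleaving pair; on an unmatched summand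
`𝕀[b, d]` this holds because `d - b < 2δ`, so that the transition morphism vanishes. -/
lemma shiftComp_eq_transition_of_matching (D : IntervalDecomposition M I)
    (E : IntervalDecomposition N J) (σ : U ≃. V)
    (h : ∀ x y, y ∈ σ x → CloseIntervals δ (I x) (J y))
    (hlong : ∀ x, (I x).fst.val + 2 * δ ≤ (I x).snd.val → ∃ y, y ∈ σ x)
    {f : M ⟶ (shift k n δ).obj N} {g : N ⟶ (shift k n δ).obj M}
    (hf₀ : ∀ x, σ x = none → D.inc x ≫ f = 0)
    (hf : ∀ x y (hxy : y ∈ σ x),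
      D.inc x ≫ f = canonicalHom k (h x y hxy).2.2 ≫ (shift k n δ).map (E.inc y))
    (hg : ∀ x y (hxy : y ∈ σ x),
      E.inc y ≫ g = canonicalHom k (h x y hxy).1.2 ≫ (shift k n δ).map (D.inc x)) :
    shiftComp f g = transition (2 * δ) M := by
  refine D.hom_ext fun x => ?_
  rw [comp_shiftComp, transition_naturality]
  rcases hx : σ x with _ | y
  · have hs : (I x).snd.val < (I x).fst.val + 2 * δ := by
      by_contra! hl
      obtain ⟨y, hy⟩ := hlong x hl
      simp [hx] at hy
    rw [hf₀ x hx, zero_shiftComp, transition_intervalRep_eq_zero hs, zero_comp]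
  · obtain ⟨⟨h₁, h₂⟩, h₃, h₄⟩ := h x y hx
    rw [hf x y hx, shiftComp_middle, hg x y hx, ← shiftComp_comp,
      shiftComp_canonicalHom h₁ h₄ h₃ h₂]

/-- The converse of algebraic stability. -/
theorem exists_isInterleavingPair_of_matched (h : Matched δ (barcode M) (barcode N)) :
    ∃ (f : M ⟶ (shift k n δ).obj N) (g : N ⟶ (shift k n δ).obj M), IsInterleavingPair δ f g := by
  obtain ⟨σ, hσ⟩ := h
  let D := barcodeDecomposition M
  let E := barcodeDecomposition N
  have hR (x y) (h : y ∈ σ x) : CloseIntervals δ x.1 y.1 :=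
    ⟨⟨hσ.fst_le x y h, hσ.le_snd x y h⟩, hσ.fst_le' x y h, hσ.le_snd' x y h⟩
  have hR' (y x) (h : x ∈ σ.symm y) : CloseIntervals δ y.1 x.1 :=
    have h' := hR x y (σ.mem_iff_mem.1 h)
    ⟨h'.2, h'.1⟩
  obtain ⟨f, hf₀, hf⟩ := exists_hom_of_matching D E σ fun x y h => (hR x y h).2.2
  obtain ⟨g, hg₀, hg⟩ := exists_hom_of_matching E D σ.symm fun y x h => (hR' y x h).2.2
  refine ⟨f, g, ?_, ?_⟩
  · exact shiftComp_eq_transition_of_matching D E σ hR hσ.coim hf₀ hf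
      fun x y h => hg y x (σ.mem_iff_mem.2 h)
  · refine shiftComp_eq_transition_of_matching E D σ.symm hR' (fun y hy => ?_) hg₀ hg
      fun y x h => hf x y (σ.mem_iff_mem.1 h)
    obtain ⟨x, hx⟩ := hσ.im y hy
    exact ⟨x, σ.mem_iff_mem.2 hx⟩

end Interleaving

/-! ### The derived category -/

section Derived

variable [HasDerivedCategory.{w} (Rep k n)]

/-- Any family of morphisms `Hⁱ(X) ⟶ Hⁱ(Y)(δ)` is induced by a morphism `X ⟶ Y(δ)`. -/
lemma exists_hom_derivedShift {δ : ℕ} {X Y : DerivedCategory.Bounded (Rep k n)}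
    (f : ∀ i, (cohomology k n i).obj X ⟶ (shift k n δ).obj ((cohomology k n i).obj Y)) :
    ∃ F : X ⟶ (derivedShift k n δ).obj Y,
      ∀ i, (cohomology k n i).map F ≫ (cohomologyShiftIso δ i Y).hom = f i := by
  obtain ⟨F, hF⟩ := exists_hom_homologyFunctor_map_eq (hasTwoTermResolutions k n) X.obj
    ((derivedShift k n δ).obj Y).obj fun i => f i ≫ (cohomologyShiftIso δ i Y).inv
  exact ⟨ObjectProperty.homMk F, fun i => (Iso.eq_comp_inv _).1 (hF i)⟩

theorem derivedMatched_iff_derivedInterleaved {δ : ℕ}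
    {X Y : DerivedCategory.Bounded (Rep k n)} :
    DerivedMatched δ (derivedBarcode X) (derivedBarcode Y) ↔ DerivedInterleaved δ X Y := by
  constructor
  · intro h
    choose f g hfg using fun i => exists_isInterleavingPair_of_matched (h i)
    obtain ⟨F, hF⟩ := exists_hom_derivedShift f
    obtain ⟨G, hG⟩ := exists_hom_derivedShift g
    exact ⟨F, G, fun i => by rw [hF, hG]; exact hfg i⟩
  · rintro ⟨F, G, h⟩ i
    exact matched_of_isInterleavingPair (h i)

end Derived

end

end DerivedPersistence

theorem theorem5p2 {k : Type u} [Field k] [IsAlgClosed k] {n : ℕ}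
    [HasDerivedCategory.{w} (DerivedPersistence.Rep k n)]
    (X Y : DerivedCategory.Bounded (DerivedPersistence.Rep k n)) :
    DerivedPersistence.derivedBottleneckDist
        (DerivedPersistence.derivedBarcode X) (DerivedPersistence.derivedBarcode Y) =
      DerivedPersistence.derivedInterleavingDist X Y := by
  simp only [DerivedPersistence.derivedBottleneckDist, DerivedPersistence.derivedInterleavingDist,
    DerivedPersistence.derivedMatched_iff_derivedInterleaved]
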